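/- **Setting.** For $\tau\in[1/2,1)$ let $\rho_\tau(z)=\tau z$ for $z\ge 0$ and $\rho_\tau(z)=(\tau-1)z$ for $z<0$, and $\rho_\tau(y)=\sum_i\rho_\tau(y_i)$ for vectors. A matrix $U\in\mathbb R^{n\times d}$ is $(\alpha,\beta)$-conditioned if $\sum_{i,j}|U_{ij}|\le\alpha$ and $\|x\|_\infty\le\beta\|Ux\|_1$ for all $x\in\mathbb R^d$; its condition number is the minimum of $\alpha\beta$ over all such pairs. $\mathrm{nnz}(A)$ is the number of nonzero entries of $A$, and $\log$ is the natural logarithm. **Algorithm.** Input: $A\in\mathbb R^{n\times d}$, an invertible $R\in\mathbb R^{d\times d}$ (given through $R^{-1}$) such that $AR^{-1}$ has condition number $\kappa$ (so $A$ has full column rank $d\ge1$), the number $\kappa$, $\varepsilon\in(0,1/2)$ and $\tau\in[1/2,1)$. Put $\mu=\tau/(1-\tau)$. 1. Let $\Pi_2\in\mathbb R^{d\times r_2}$ have independent standard Cauchy entries, where $r_2=\lceil 15\log(40n)\rceil$. 2. Compute $\Lambda=A(R^{-1}\Pi_2)$. 3. Let $\lambda_i=\mathrm{median}_{j}|\Lambda_{ij}|$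 for $i=1,\dots,n$. 4. Let $s=\mu\,\frac{81\kappa}{\varepsilon^2}\left(d\log\frac{18\mu}{\varepsilon}+\log 80\right)$ and $\hat p_i=\min\{1,\ s\lambda_i/\sum_k\lambda_k\}$. 5. Let $S\in\mathbb R^{n\times n}$ be diagonal with entries that are independent given $\Pi_2$, $S_{ii}=1/\hat p_i$ with probability $\hat p_i$ and $S_{ii}=0$ otherwise. Let $\hat s$ be the number of nonzero rows of $S$ (deleting the zero rows gives the $\hat s\times n$ sampling matrix). **Proposition.** There are absolute constants $C_1,C_2$ and a function $\delta$ with $\delta(N)\to0$ as $N\to\infty$ such that for all such $A,R,\kappa,\varepsilon,\tau$ the following hold. (a) *(Running time.)* In the unit-cost real-number model (arithmetic operations, logarithms, comparisons, access to an entry of the input and drawing a random number cost one step each, and bookkeeping is charged too), $A$ being given in compressed sparse row format, the algorithm, implemented without touching zero rows and with linear-time selection for the medians, outputs (the nonzero entries of) $S$. For all $n\ge2$ and whatever the random numbers are, it takes at most $C_1\,(\mathrm{nnz}(A)+d^2)\log n$ steps, and at most $C_1\,\mathrm{nnz}(A)\log n$ steps if $d^2\le\mathrm{nnz}(A)$.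 (b) *(Distortion.)* With probability at least $0.9$, $(1-\varepsilon)\rho_\tau(Ax)\le\rho_\tau(SAx)\le(1+\varepsilon)\rho_\tau(Ax)$ for all $x\in\mathbb R^d$. (c) *(Sample size.)* Let $N=\mu\kappa d\log(\mu/\varepsilon)/\varepsilon^2$. Then $\hat s\le C_2N$ with probability at least $1-\delta(N)$. -/

import Mathlib

open MeasureTheory ProbabilityTheory Filter Topology

namespace QuantileSampling

/-! ### Loss function, conditioning, number of nonzeros -/

/-- The tilted absolute value `ρ_τ(z)` of a real number. -/
noncomputable def rho (τ z : ℝ) : ℝ := if 0 ≤ z then τ * z else (τ - 1) * z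

/-- The quantile loss `ρ_τ(y) = ∑ i, ρ_τ(y i)` of a vector. -/
noncomputable def quantileLoss {n : ℕ} (τ : ℝ) (y : Fin n → ℝ) : ℝ := ∑ i, rho τ (y i)

/-- `U` is `(α, β)`-conditioned: its entrywise `ℓ1` norm is at most `α`, and
`‖x‖_∞ ≤ β ‖U x‖_1` for all `x` (the norm on `Fin d → ℝ` is the sup norm). -/
def IsConditioned {n d : ℕ} (α β : ℝ) (U : Matrix (Fin n) (Fin d) ℝ) : Prop :=
  ∑ i, ∑ j, |U i j| ≤ α ∧ ∀ x : Fin d → ℝ, ‖x‖ ≤ β * ∑ i, |U.mulVec x i|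

/-- `κ` is the condition number of `U`: the minimum of `α * β` over all `(α, β)` such that `U`
is `(α, β)`-conditioned. (Such a minimum can only exist if `U` has full column rank and at least
one column.) -/
def IsConditionNumber {n d : ℕ} (U : Matrix (Fin n) (Fin d) ℝ) (κ : ℝ) : Prop :=
  IsLeast {c : ℝ | ∃ α β : ℝ, IsConditioned α β U ∧ c = α * β} κ

/-- The number of nonzero entries of `A`. -/
noncomputable def nnz {n d : ℕ} (A : Matrix (Fin n) (Fin d) ℝ) : ℕ :=
  (Finset.univ.filter fun q : Fin n × Fin d => A q.1 q.2 ≠ 0).card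

/-! ### The sampling algorithm, mathematically -/

/-- The number `r₂ = 15 log (40 n)` of Cauchy projections, rounded up to an integer. -/
noncomputable def numProj (n : ℕ) : ℕ := ⌈15 * Real.log (40 * n)⌉₊

/-- The median of `r` reals: the middle order statistic for odd `r`, the average of the two
middle order statistics for even `r`. -/
noncomputable def median {r : ℕ} (f : Fin r → ℝ) : ℝ :=
  let s := (Finset.univ.val.map f).sort
  (s.getD ((r - 1) / 2) 0 + s.getD (r / 2) 0) / 2

/-- The estimate `λ_i = median_l |(A R⁻¹ Π₂)_{il}|` of the `ℓ1` norm of row `i` of `A R⁻¹`. -/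
noncomputable def rowEstimate {n d r : ℕ} (A : Matrix (Fin n) (Fin d) ℝ)
    (R : Matrix (Fin d) (Fin d) ℝ) (G : Matrix (Fin d) (Fin r) ℝ) (i : Fin n) : ℝ :=
  median fun l => |(A * (R⁻¹ * G)) i l|

/-- The desired sampling complexity
`s = τ/(1-τ) * 81 κ/ε² * (d log (τ/(1-τ) * 18/ε) + log 80)`. -/
noncomputable def sampleSize (d : ℕ) (κ ε τ : ℝ) : ℝ :=
  τ / (1 - τ) * (81 * κ / ε ^ 2) *
    (d * Real.log (τ / (1 - τ) * (18 / ε)) + Real.log 80)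

/-- The probability `p̂_i = min {1, s λ_i / ∑ λ}` of keeping row `i`. -/
noncomputable def keepProb {n d r : ℕ} (A : Matrix (Fin n) (Fin d) ℝ)
    (R : Matrix (Fin d) (Fin d) ℝ) (κ ε τ : ℝ) (G : Matrix (Fin d) (Fin r) ℝ) (i : Fin n) : ℝ :=
  min 1 (sampleSize d κ ε τ * (rowEstimate A R G i / ∑ k, rowEstimate A R G k))

/-- The randomness of the algorithm: the entries of the `d × r` matrix `Π₂`, and one uniform
number in `[0, 1]` per row, used to toss the coin of that row. -/
abbrev Seed (n d r : ℕ) : Type := (Fin d → Fin r → ℝ) × (Fin n → unitInterval)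

/-- The law of the randomness: all numbers are independent, the entries of `Π₂` are standard
Cauchy and the other numbers are uniform on `[0, 1]`. -/
noncomputable def seedLaw (n d r : ℕ) : Measure (Seed n d r) :=
  (Measure.pi fun _ => Measure.pi fun _ => cauchyMeasure 0 1).prod (Measure.pi fun _ => volume)

/-- The sampling matrix: diagonal, with `S_ii = 1 / p̂_i` if the uniform number of row `i` is less
than `p̂_i` (an event of probability `p̂_i` given `Π₂`), and `S_ii = 0` otherwise. -/
noncomputable def samplingMatrix {n d r : ℕ} (A : Matrix (Fin n) (Fin d) ℝ)
    (R : Matrix (Fin d) (Fin d) ℝ) (κ ε τ : ℝ) (ω : Seed n d r) : Matrix (Fin n) (Fin n) ℝ :=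
  Matrix.diagonal fun i =>
    if (ω.2 i : ℝ) < keepProb A R κ ε τ (Matrix.of ω.1) i
      then 1 / keepProb A R κ ε τ (Matrix.of ω.1) i else 0

/-- The number `ŝ` of sampled rows, i.e. of rows of `S` that are not zero. -/
noncomputable def numSampled {n : ℕ} (S : Matrix (Fin n) (Fin n) ℝ) : ℕ :=
  (Finset.univ.filter fun i => S i i ≠ 0).card

/-- `S` satisfies `(1 - ε) ρ_τ(Ax) ≤ ρ_τ(SAx) ≤ (1 + ε) ρ_τ(Ax)` for all `x`. -/
def IsDistortionEmbedding {n d : ℕ} (ε τ : ℝ) (A : Matrix (Fin n) (Fin d) ℝ)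
    (S : Matrix (Fin n) (Fin n) ℝ) : Prop :=
  ∀ x : Fin d → ℝ,
    (1 - ε) * quantileLoss τ (A.mulVec x) ≤ quantileLoss τ ((S * A).mulVec x) ∧
    quantileLoss τ ((S * A).mulVec x) ≤ (1 + ε) * quantileLoss τ (A.mulVec x)

/-! ### Step-counted real-number computations

A computation of type `Comp ι V α` returns an `α`. It has an input memory with cells addressed by
`ι`, holding numbers of a type `V` about which it knows nothing: programs below are written for
an arbitrary `V` without any operations, so that the only thing they can do with numbers is to use
the following instructions. Every instruction costs one step; the bookkeeping (loops, list and
array handling) is charged by explicit `tick` instructions. -/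

/-- The arithmetic operations. -/
inductive ArithOp : Type
  | add | sub | mul | div

/-- Computations in the real-number machine model. -/
inductive Comp (ι V α : Type) : Type
  /-- stop and return `a` -/
  | ret (a : α) : Comp ι V α
  /-- spend `m` steps on bookkeeping -/
  | tick (m : ℕ) (next : Comp ι V α) : Comp ι V α
  /-- read an input cell (or a random number) -/
  | read (c : ι) (next : V → Comp ι V α) : Comp ι V α
  /-- load an integer constant -/
  | const (m : ℕ) (next : V → Comp ι V α) : Comp ι V α
  /-- an arithmetic operation -/
  | arith (o : ArithOp) (x y : V) (next : V → Comp ι V α) : Comp ι V α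
  /-- a natural logarithm -/
  | log (x : V) (next : V → Comp ι V α) : Comp ι V α
  /-- a comparison `x < y` -/
  | less (x y : V) (next : Bool → Comp ι V α) : Comp ι V α

/-- Real arithmetic. -/
noncomputable def ArithOp.eval : ArithOp → ℝ → ℝ → ℝ
  | .add, x, y => x + y
  | .sub, x, y => x - y
  | .mul, x, y => x * y
  | .div, x, y => x / y

namespace Comp

/-- Execution over the reals, with input memory `mem`: the result and the number of steps. -/
noncomputable def run {ι α : Type} (mem : ι → ℝ) : Comp ι ℝ α → α × ℕ
  | ret a => (a, 0)
  | tick m next => ((run mem next).1, (run mem next).2 + m)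
  | read c next => ((run mem (next (mem c))).1, (run mem (next (mem c))).2 + 1)
  | const m next => ((run mem (next m)).1, (run mem (next m)).2 + 1)
  | arith o x y next =>
      ((run mem (next (o.eval x y))).1, (run mem (next (o.eval x y))).2 + 1)
  | log x next => ((run mem (next (Real.log x))).1, (run mem (next (Real.log x))).2 + 1)
  | less x y next =>
      ((run mem (next (decide (x < y)))).1, (run mem (next (decide (x < y)))).2 + 1)

/-- Sequential composition. -/
def bind {ι V α β : Type} : Comp ι V α → (α → Comp ι V β) → Comp ι V β
  | ret a, f => f a
  | tick m next, f => tick m (bind next f)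
  | read c next, f => read c fun v => bind (next v) f
  | const m next, f => const m fun v => bind (next v) f
  | arith o x y next, f => arith o x y fun v => bind (next v) f
  | log x next, f => log x fun v => bind (next v) f
  | less x y next, f => less x y fun b => bind (next b) f

instance {ι V : Type} : Monad (Comp ι V) where
  pure := ret
  bind := bind

end Comp

section Programs

variable {ι V : Type}

/-- Spend `m` steps. -/
def charge (m : ℕ) : Comp ι V Unit := .tick m (.ret ())

/-- Read the cell `c`. -/
def readCell (c : ι) : Comp ι V V := .read c .ret

/-- The integer constant `m`. -/
def constant (m : ℕ) : Comp ι V V := .const m .ret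

/-- `x + y` -/
def plus (x y : V) : Comp ι V V := .arith .add x y .ret

/-- `x - y` -/
def minus (x y : V) : Comp ι V V := .arith .sub x y .ret

/-- `x * y` -/
def times (x y : V) : Comp ι V V := .arith .mul x y .ret

/-- `x / y` -/
def quotient (x y : V) : Comp ι V V := .arith .div x y .ret

/-- `log x` -/
def logarithm (x : V) : Comp ι V V := .log x .ret

/-- `x < y` -/
def isLess (x y : V) : Comp ι V Bool := .less x y .ret

/-- `|x|` -/
def absValue (x : V) : Comp ι V V := do
  let z ← constant 0
  let b ← isLess x z
  if b then minus z x else pure x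

/-- `min 1 x` -/
def minOne (x : V) : Comp ι V V := do
  let o ← constant 1
  let b ← isLess x o
  if b then pure x else pure o

/-- Fill an array of length `n`, whose `i`-th entry is computed by `f i`. -/
def tabulate {α : Type} : (n : ℕ) → (Fin n → Comp ι V α) → Comp ι V (Fin n → α)
  | 0, _ => do
      charge 1
      pure Fin.elim0
  | n + 1, f => do
      charge 1
      let a ← f 0
      let t ← tabulate n fun i => f i.succ
      pure (Fin.cons a t)

/-- Execute `f` on each element of a list, and list the results. -/
def forEach {α β : Type} (f : α → Comp ι V β) : List α → Comp ι V (List β)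
  | [] => do
      charge 1
      pure []
  | a :: l => do
      charge 1
      let b ← f a
      let t ← forEach f l
      pure (b :: t)

/-- The sum of the numbers computed by `f` on the elements of a list. -/
def sumOver {α : Type} (f : α → Comp ι V V) : List α → Comp ι V V
  | [] => constant 0
  | a :: l => do
      charge 1
      let x ← f a
      let y ← sumOver f l
      plus x y

/-- Insert `x` into a sorted list. -/
def insertSorted (x : V) : List V → Comp ι V (List V)
  | [] => do
      charge 1
      pure [x]
  | y :: l => do
      charge 1
      let b ← isLess y x
      if b then do
        let t ← insertSorted x l
        pure (y :: t)
      else pure (x :: y :: l)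

/-- Insertion sort, only used on lists of bounded length. -/
def insertionSort : List V → Comp ι V (List V)
  | [] => do
      charge 1
      pure []
  | x :: l => do
      charge 1
      let t ← insertionSort l
      insertSorted x t

/-- The medians of consecutive groups of five elements (an incomplete last group is dropped). -/
def groupMedians : List V → Comp ι V (List V)
  | a :: b :: c :: e :: f :: l => do
      charge 1
      let g ← insertionSort [a, b, c, e, f]
      let t ← groupMedians l
      pure (g.getD 2 a :: t)
  | _ => do
      charge 1
      pure []

/-- Split a list into the list of the elements less than `p`, the number of the elements equal to
`p`, and the list of the elements greater than `p`. -/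
def splitAt (p : V) : List V → Comp ι V (List V × ℕ × List V)
  | [] => do
      charge 1
      pure ([], 0, [])
  | x :: l => do
      charge 1
      let t ← splitAt p l
      let b ← isLess x p
      if b then pure (x :: t.1, t.2.1, t.2.2)
      else do
        let b' ← isLess p x
        if b' then pure (t.1, t.2.1, x :: t.2.2)
        else pure (t.1, t.2.1 + 1, t.2.2)

/-- The `k`-th smallest element (counted from `0`) of a list, by selection with the median of the
medians of groups of five as pivot. The first argument bounds the depth of the recursion (the length
of the list plus one suffices), and `z` is returned in exceptional cases. -/
def select (z : V) : ℕ → List V → ℕ → Comp ι V V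
  | 0, _, _ => pure z
  | fuel + 1, xs, k => do
      charge (xs.length + 1)
      if xs.length ≤ 100 then do
        let g ← insertionSort xs
        charge (g.length + 1)
        pure (g.getD k z)
      else do
        let ms ← groupMedians xs
        charge (ms.length + 1)
        let p ← select z fuel ms (ms.length / 2)
        let t ← splitAt p xs
        charge (t.1.length + 1)
        if k < t.1.length then select z fuel t.1 k
        else if k < t.1.length + t.2.1 then pure p
        else select z fuel t.2.2 (k - t.1.length - t.2.1)

/-- The median of the numbers in an array. -/
def medianProg {r : ℕ} (t : Fin r → V) : Comp ι V V := do
  charge (r + 1)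
  let z ← constant 0
  let a ← select z (r + 1) (List.ofFn t) ((r - 1) / 2)
  let b ← select z (r + 1) (List.ofFn t) (r / 2)
  let s ← plus a b
  let two ← constant 2
  quotient s two

end Programs

/-- The cells of the input memory of the sampling algorithm: the entries of `A`, of `R⁻¹` and of
the random matrix `Π₂`, the uniform random numbers, and the parameters. -/
inductive Cell (n d r : ℕ) : Type
  | entry (i : Fin n) (j : Fin d)
  | inv (j k : Fin d)
  | cauchy (k : Fin d) (l : Fin r)
  | coin (i : Fin n)
  | kappa
  | eps
  | tau

/-- The contents of the input memory. -/
noncomputable def memory {n d r : ℕ} (A : Matrix (Fin n) (Fin d) ℝ) (R : Matrix (Fin d) (Fin d) ℝ)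
    (κ ε τ : ℝ) (ω : Seed n d r) : Cell n d r → ℝ
  | .entry i j => A i j
  | .inv j k => R⁻¹ j k
  | .cauchy k l => ω.1 k l
  | .coin i => (ω.2 i : ℝ)
  | .kappa => κ
  | .eps => ε
  | .tau => τ

/-- The sparsity pattern of `A` in compressed row form: the nonzero rows, in order, each with the
column indices of its nonzero entries. -/
noncomputable def sparsityPattern {n d : ℕ} (A : Matrix (Fin n) (Fin d) ℝ) :
    List (Fin n × List (Fin d)) :=
  ((List.finRange n).map fun i => (i, (List.finRange d).filter fun j => A i j ≠ 0)).filter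
    fun q => q.2 ≠ []

section Algorithm

variable {V : Type} {n d r : ℕ}

/-- Compute the desired sampling complexity. -/
def sampleSizeProg : Comp (Cell n d r) V V := do
  let κ ← readCell .kappa
  let ε ← readCell .eps
  let τ ← readCell .tau
  let one ← constant 1
  let c ← minus one τ
  let μ ← quotient τ c
  let c81 ← constant 81
  let a ← times c81 κ
  let e2 ← times ε ε
  let q ← quotient a e2
  let m ← times μ q
  let c18 ← constant 18
  let w ← quotient c18 ε
  let v ← times μ w
  let lv ← logarithm v
  let dd ← constant d
  let t ← times dd lv
  let c80 ← constant 80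
  let l80 ← logarithm c80
  let b ← plus t l80
  times m b

/-- The sampling algorithm, for a matrix `A` with sparsity pattern `rows`. It returns the selected
rows `i` with the diagonal entries `S_ii`. Rows of `A` that are zero are not touched. -/
def samplingProg (rows : List (Fin n × List (Fin d))) :
    Comp (Cell n d r) V (List (Fin n × V)) := do
  -- draw the random matrix
  let P ← tabulate d fun k => tabulate r fun l => readCell (.cauchy k l)
  -- multiply it by the inverse of `R`
  let G ← tabulate d fun j => tabulate r fun l =>
    sumOver (fun k => do
      let x ← readCell (.inv j k)
      times x (P k l)) (List.finRange d)
  -- multiply by `A`, row by row, and take medians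
  let est ← forEach (fun q => do
    let row ← tabulate r fun l => do
      let x ← sumOver (fun j => do
        let a ← readCell (.entry q.1 j)
        times a (G j l)) q.2
      absValue x
    let m ← medianProg row
    pure (q.1, m)) rows
  -- compute the probabilities
  let total ← sumOver (fun e => pure e.2) est
  let s ← sampleSizeProg
  let prob ← forEach (fun e => do
    let x ← quotient e.2 total
    let y ← times s x
    let p ← minOne y
    pure (e.1, p)) est
  -- toss the coins
  let out ← forEach (fun e => do
    let u ← readCell (.coin e.1)
    let b ← isLess u e.2
    if b then do
      let one ← constant 1
      let w ← quotient one e.2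
      pure [(e.1, w)]
    else pure []) prob
  charge (out.length + 1)
  pure out.flatten

end Algorithm

/-- The list of the nonzero diagonal entries of `S`, with their positions. -/
noncomputable def diagonalList {n : ℕ} (S : Matrix (Fin n) (Fin n) ℝ) : List (Fin n × ℝ) :=
  ((List.finRange n).filter fun i => S i i ≠ 0).map fun i => (i, S i i)

/-- Execution of the sampling algorithm on `A`, given `R⁻¹`, the parameters and the random numbers:
the output and the number of steps. -/
noncomputable def execute {n d r : ℕ} (A : Matrix (Fin n) (Fin d) ℝ) (R : Matrix (Fin d) (Fin d) ℝ)
    (κ ε τ : ℝ) (ω : Seed n d r) : List (Fin n × ℝ) × ℕ :=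
  (samplingProg (sparsityPattern A)).run (memory A R κ ε τ ω)

end QuantileSampling

namespace QuantileSampling

/-! ### Execution of composite programs -/

section Run

variable {ι α β : Type} (mem : ι → ℝ)

/-! The running time is deterministic. Steps add up along `bind`, so every subprogram comes with its
value and a step bound. Selection is linear because the median of the medians of groups of five has
about 3/10 of the list on either side (`run_select`). With r projections, the sparse product and the
medians cost O(r nnz(A)), the product R⁻¹Π₂ costs O(r d²) (`execute_snd_le`), and r = O(log n)
(`numProj_le`). Zero rows may be skipped because their estimates vanish.

For the distortion put U = A R⁻¹, which has the same range as A. The Cauchy law is 1-stable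
(`map_sum_mul_pi_cauchyMeasure`), so the entries of row i of Λ are independent Cauchy variables
scaled by the ℓ1 norm of row i of U. A Chernoff bound puts their median within the factors 9/20 and
20/9 of that norm, for all rows at once outside an event of probability 1/20
(`real_not_goodEstimates_le`). Conditioning bounds the i-th term of the loss of Ux by a multiple M
of p̂_i whenever p̂_i < 1 (`rho_le_mul_keepProb`); the factor μ enters because ρ_τ(z) lies between
(1-τ)|z| and τ|z|. This is what the Bernstein inequality `coin_bernstein` needs, and s is chosen so
that the loss of one fixed vector is off by a factor ε/2 with probability at most 2 (18μ/ε)^(-d) /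
80 while the estimates are good (`loss_deviation_le`). A union bound over a net of at most (18μ/ε)^d
points of the ℓ1 unit sphere of the range costs 1/40, and sublinearity of the loss carries the
estimate from the net to all vectors (`distortion_of_net`).

The sample size does not depend on the quality of the estimates: the p̂_i sum to at most s, which is
O(N), so the number of successes has an exponential tail (`numSampled_tail`). -/

theorem run_bind (x : Comp ι ℝ α) (f : α → Comp ι ℝ β) :
    (x >>= f).run mem =
      (((f (x.run mem).1).run mem).1, (x.run mem).2 + ((f (x.run mem).1).run mem).2) := by
  change (Comp.bind x f).run mem = _
  induction x with
  | ret a => simp [Comp.bind, Comp.run]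
  | tick m next ih => simp only [Comp.bind, Comp.run, ih]; ext <;> simp; ring
  | read c next ih => simp only [Comp.bind, Comp.run, ih]; ext <;> simp; ring
  | const c next ih => simp only [Comp.bind, Comp.run, ih]; ext <;> simp; ring
  | arith o x y next ih => simp only [Comp.bind, Comp.run, ih]; ext <;> simp; ring
  | log c next ih => simp only [Comp.bind, Comp.run, ih]; ext <;> simp; ring
  | less x y next ih => simp only [Comp.bind, Comp.run, ih]; ext <;> simp; ring

@[simp] theorem run_bind_fst (x : Comp ι ℝ α) (f : α → Comp ι ℝ β) :
    ((x >>= f).run mem).1 = ((f (x.run mem).1).run mem).1 := by rw [run_bind]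

@[simp] theorem run_bind_snd (x : Comp ι ℝ α) (f : α → Comp ι ℝ β) :
    ((x >>= f).run mem).2 = (x.run mem).2 + ((f (x.run mem).1).run mem).2 := by rw [run_bind]

@[simp] theorem run_pure (a : α) : (pure a : Comp ι ℝ α).run mem = (a, 0) := rfl

@[simp] theorem run_charge (m : ℕ) : (charge m : Comp ι ℝ Unit).run mem = ((), m) := by
  simp [charge, Comp.run]

@[simp] theorem run_readCell (c : ι) : (readCell c).run mem = (mem c, 1) := rfl

@[simp] theorem run_constant (m : ℕ) : (constant m : Comp ι ℝ ℝ).run mem = ((m : ℝ), 1) := rfl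

@[simp] theorem run_plus (x y : ℝ) : (plus x y).run mem = (x + y, 1) := rfl

@[simp] theorem run_minus (x y : ℝ) : (minus x y).run mem = (x - y, 1) := rfl

@[simp] theorem run_times (x y : ℝ) : (times x y).run mem = (x * y, 1) := rfl

@[simp] theorem run_quotient (x y : ℝ) : (quotient x y).run mem = (x / y, 1) := rfl

@[simp] theorem run_logarithm (x : ℝ) : (logarithm x).run mem = (Real.log x, 1) := rfl

@[simp] theorem run_isLess (x y : ℝ) : (isLess x y).run mem = (decide (x < y), 1) := rfl

theorem run_absValue_fst (x : ℝ) : ((absValue x).run mem).1 = |x| := by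
  by_cases h : x < 0
  · simp [absValue, h, abs_of_neg h]
  · simp [absValue, h, abs_of_nonneg (not_lt.1 h)]

theorem run_absValue_snd_le (x : ℝ) : ((absValue x).run mem).2 ≤ 3 := by
  by_cases h : x < 0 <;> simp [absValue, h]

theorem run_minOne_fst (x : ℝ) : ((minOne x).run mem).1 = min 1 x := by
  by_cases h : x < 1
  · simp [minOne, h, h.le]
  · simp [minOne, h, not_lt.1 h]

theorem run_minOne_snd_le (x : ℝ) : ((minOne x).run mem).2 ≤ 2 := by
  by_cases h : x < 1 <;> simp [minOne, h]

theorem run_tabulate_fst : ∀ (n : ℕ) (f : Fin n → Comp ι ℝ α),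
    ((tabulate n f).run mem).1 = fun i => ((f i).run mem).1
  | 0, f => by ext i; exact i.elim0
  | n + 1, f => by
      ext i
      simp only [tabulate, run_bind_fst, run_tabulate_fst n, run_pure]
      refine Fin.cases ?_ (fun j => ?_) i <;> simp

theorem run_tabulate_snd_le (c : ℕ) : ∀ (n : ℕ) (f : Fin n → Comp ι ℝ α),
    (∀ i, ((f i).run mem).2 ≤ c) → ((tabulate n f).run mem).2 ≤ n * (c + 1) + 1
  | 0, f, _ => by simp [tabulate]
  | n + 1, f, h => by
      simp only [tabulate, run_bind_snd, run_charge, run_pure]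
      have h1 := run_tabulate_snd_le c n (fun i => f i.succ) fun i => h i.succ
      have h2 := h 0
      nlinarith

theorem run_forEach_fst (f : α → Comp ι ℝ β) : ∀ l : List α,
    ((forEach f l).run mem).1 = l.map fun a => ((f a).run mem).1
  | [] => by simp [forEach]
  | a :: l => by simp [forEach, run_forEach_fst f l]

theorem run_forEach_snd (f : α → Comp ι ℝ β) : ∀ l : List α,
    ((forEach f l).run mem).2 = (l.map fun a => ((f a).run mem).2 + 1).sum + 1
  | [] => by simp [forEach]
  | a :: l => by simp [forEach, run_forEach_snd f l]; ring

theorem run_sumOver_fst (f : α → Comp ι ℝ ℝ) : ∀ l : List α,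
    ((sumOver f l).run mem).1 = (l.map fun a => ((f a).run mem).1).sum
  | [] => by simp [sumOver]
  | a :: l => by simp [sumOver, run_sumOver_fst f l]

theorem run_sumOver_snd_le (f : α → Comp ι ℝ ℝ) (c : ℕ) (h : ∀ a, ((f a).run mem).2 ≤ c) :
    ∀ l : List α, ((sumOver f l).run mem).2 ≤ l.length * (c + 2) + 1
  | [] => by simp [sumOver]
  | a :: l => by
      have h1 := run_sumOver_snd_le f c h l
      have h2 := h a
      simp [sumOver]
      nlinarith

theorem run_insertSorted_fst (x : ℝ) : ∀ l : List ℝ,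
    ((insertSorted x l).run mem).1 = l.orderedInsert (· ≤ ·) x
  | [] => by simp [insertSorted]
  | y :: l => by
      simp only [insertSorted, run_bind_fst, run_isLess, List.orderedInsert_cons]
      by_cases h : x ≤ y
      · simp [h, not_lt.2 h]
      · simp [h, not_le.1 h, run_insertSorted_fst x l]

theorem run_insertSorted_snd_le (x : ℝ) : ∀ l : List ℝ,
    ((insertSorted x l).run mem).2 ≤ 2 * l.length + 1
  | [] => by simp [insertSorted]
  | y :: l => by
      have := run_insertSorted_snd_le x l
      simp only [insertSorted, run_bind_snd, run_isLess, run_charge, List.length_cons]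
      by_cases h : y < x <;> simp [h] <;> omega

theorem run_insertionSort_fst : ∀ l : List ℝ,
    ((insertionSort l).run mem).1 = l.insertionSort (· ≤ ·)
  | [] => by simp [insertionSort]
  | x :: l => by simp [insertionSort, run_insertionSort_fst l, run_insertSorted_fst]

theorem run_insertionSort_snd_le : ∀ l : List ℝ,
    ((insertionSort l).run mem).2 ≤ l.length * (2 * l.length + 2) + 1
  | [] => by simp [insertionSort]
  | x :: l => by
      have h1 := run_insertionSort_snd_le l
      have h2 := run_insertSorted_snd_le mem x (l.insertionSort (· ≤ ·))
      rw [List.length_insertionSort] at h2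
      simp [insertionSort, run_insertionSort_fst]
      nlinarith

theorem run_splitAt_fst (p : ℝ) : ∀ l : List ℝ, ((splitAt p l).run mem).1 =
    (l.filter (· < p), l.countP (· = p), l.filter (p < ·))
  | [] => by simp [splitAt]
  | x :: l => by
      simp only [splitAt, run_bind_fst, run_isLess, run_splitAt_fst p l]
      rcases lt_trichotomy x p with h | h | h
      · simp [h, h.not_gt, h.ne]
      · simp [h]
      · simp [h, h.not_gt, h.ne']

theorem run_splitAt_snd_le (p : ℝ) : ∀ l : List ℝ,
    ((splitAt p l).run mem).2 ≤ 3 * l.length + 1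
  | [] => by simp [splitAt]
  | x :: l => by
      have := run_splitAt_snd_le p l
      simp only [splitAt, run_bind_snd, run_isLess, run_charge, List.length_cons]
      by_cases h : x < p
      · simp [h]; omega
      · by_cases h' : p < x <;> simp [h, h'] <;> omega

end Run

/-! ### Order statistics -/

/-- `x` is the `k`-th smallest element (counted from `0`) of the list `xs`. -/
def IsKth (xs : List ℝ) (k : ℕ) (x : ℝ) : Prop :=
  x ∈ xs ∧ xs.countP (· < x) ≤ k ∧ k < xs.countP (· ≤ x)

/-- If x < y, everything counted by ≤ x is counted by < y, so the two ranks differ. Uniqueness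
identifies the output of selection with the entry of the sorted list used in `median`. -/
theorem IsKth.unique {xs : List ℝ} {k : ℕ} {x y : ℝ} (hx : IsKth xs k x) (hy : IsKth xs k y) :
    x = y := by
  have key : ∀ {x y : ℝ}, IsKth xs k x → IsKth xs k y → ¬ x < y := by
    intro x y hx hy h
    have : xs.countP (· ≤ x) ≤ xs.countP (· < y) :=
      List.countP_mono_left fun z _ hz => by
        simp only [decide_eq_true_eq] at hz ⊢; exact hz.trans_lt h
    have := hx.2.2
    have := hy.2.1
    omega
  exact le_antisymm (not_lt.1 (key hy hx)) (not_lt.1 (key hx hy))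

theorem IsKth.perm {xs ys : List ℝ} {k : ℕ} {x : ℝ} (h : xs.Perm ys) (hx : IsKth xs k x) :
    IsKth ys k x :=
  ⟨h.mem_iff.1 hx.1, h.countP_eq _ ▸ hx.2.1, h.countP_eq _ ▸ hx.2.2⟩

theorem isKth_getD_of_pairwise {l : List ℝ} (hl : l.Pairwise (· ≤ ·)) {k : ℕ} (hk : k < l.length)
    (z : ℝ) : IsKth l k (l.getD k z) := by
  rw [List.getD_eq_getElem _ _ hk]
  refine ⟨List.getElem_mem _, ?_, ?_⟩
  · generalize hm : l[k] = m
    rw [← List.take_append_drop k l, List.countP_append, ← hm]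
    have h0 : (l.drop k).countP (· < l[k]) = 0 := by
      rw [List.countP_eq_zero]
      intro a ha
      obtain ⟨i, hi, rfl⟩ := List.mem_iff_getElem.1 ha
      simp only [List.getElem_drop, decide_eq_true_eq, not_lt]
      rcases Nat.eq_zero_or_pos i with rfl | hi'
      · simp
      · exact List.pairwise_iff_getElem.1 hl _ _ _ _ (by omega)
    have h1 := List.countP_le_length (p := fun x => decide (x < l[k])) (l := l.take k)
    rw [List.length_take] at h1
    omega
  · have h1 : (l.take (k + 1)).countP (· ≤ l[k]) = (l.take (k + 1)).length := by
      rw [List.countP_eq_length]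
      intro a ha
      obtain ⟨i, hi, rfl⟩ := List.mem_iff_getElem.1 ha
      rw [List.length_take] at hi
      simp only [List.getElem_take, decide_eq_true_eq]
      rcases (show i ≤ k by omega).eq_or_lt with rfl | hi'
      · simp
      · exact List.pairwise_iff_getElem.1 hl _ _ _ _ hi'
    have h2 := (List.take_sublist (k + 1) l).countP_le (p := fun x => decide (x ≤ l[k]))
    rw [h1, List.length_take] at h2
    omega

theorem countP_le_eq (p : ℝ) : ∀ l : List ℝ,
    l.countP (· ≤ p) = l.countP (· < p) + l.countP (· = p)
  | [] => rfl
  | x :: l => by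
      simp only [List.countP_cons, countP_le_eq p l]
      rcases lt_trichotomy x p with h | h | h
      · simp [h, h.ne, h.le]; omega
      · simp [h]; omega
      · simp [h.not_ge, h.ne', h.not_gt]

theorem length_eq_countP_le_add (p : ℝ) (l : List ℝ) :
    l.length = l.countP (· ≤ p) + l.countP (p < ·) := by
  rw [List.length_eq_countP_add_countP (p := fun x => decide (x ≤ p))]
  congr 1
  apply List.countP_congr
  intro x _; simp

theorem length_eq_countP_ge_add (p : ℝ) (l : List ℝ) :
    l.length = l.countP (p ≤ ·) + l.countP (· < p) := by
  rw [List.length_eq_countP_add_countP (p := fun x => decide (p ≤ x))]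
  congr 1
  apply List.countP_congr
  intro x _; simp

theorem IsKth.of_filter_lt {xs : List ℝ} {p : ℝ} {k : ℕ} {x : ℝ}
    (h : IsKth (xs.filter (· < p)) k x) : IsKth xs k x := by
  obtain ⟨h1, h2, h3⟩ := h
  obtain ⟨hx, hp⟩ := List.mem_filter.1 h1
  simp only [decide_eq_true_eq] at hp
  rw [List.countP_filter] at h2 h3
  refine ⟨hx, ?_, ?_⟩
  · refine le_trans (List.countP_mono_left fun z _ hz => ?_) h2
    simp only [decide_eq_true_eq] at hz
    simp [hz, hz.trans hp]
  · refine h3.trans_le (List.countP_mono_left fun z _ hz => ?_)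
    simp at hz
    simpa using hz.1

theorem IsKth.of_filter_gt {xs : List ℝ} {p : ℝ} {k : ℕ} {x : ℝ}
    (hk : xs.countP (· ≤ p) ≤ k)
    (h : IsKth (xs.filter (p < ·)) (k - xs.countP (· ≤ p)) x) : IsKth xs k x := by
  obtain ⟨h1, h2, h3⟩ := h
  obtain ⟨hx, hp⟩ := List.mem_filter.1 h1
  simp only [decide_eq_true_eq] at hp
  -- Only predicates that hold on everything up to p are counted, so the discarded elements
  -- contribute all of themselves.
  have key : ∀ q : ℝ → Bool, (∀ y ≤ p, q y = true) → ∀ l : List ℝ,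
      l.countP q = l.countP (· ≤ p) + (l.filter (p < ·)).countP q := by
    intro q hq l
    induction l with
    | nil => rfl
    | cons y l ih =>
      by_cases hy : y ≤ p
      · simp [hy, hq y hy, ih, not_lt.2 hy]; omega
      · simp [hy, List.countP_cons, ih, not_le.1 hy]; omega
  refine ⟨hx, ?_, ?_⟩
  · rw [key _ (fun y hy => by simpa using hy.trans_lt hp)]; omega
  · rw [key _ (fun y hy => by simpa using hy.trans hp.le)]; omega

theorem isKth_pivot {xs : List ℝ} {p : ℝ} {k : ℕ} (h1 : xs.countP (· < p) ≤ k)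
    (h2 : k < xs.countP (· < p) + xs.countP (· = p)) : IsKth xs k p := by
  refine ⟨?_, h1, by rw [countP_le_eq]; exact h2⟩
  have : 0 < xs.countP (· = p) := by omega
  obtain ⟨a, ha, hap⟩ := List.countP_pos_iff.1 this
  simp only [decide_eq_true_eq] at hap
  exact hap ▸ ha

/-! ### Medians of groups -/

section Select

variable {ι : Type} (mem : ι → ℝ)

theorem three_le_countP_insertionSort (l : List ℝ) (hl : l.length = 5) (z : ℝ) :
    let m := (l.insertionSort (· ≤ ·)).getD 2 z
    3 ≤ l.countP (· ≤ m) ∧ 3 ≤ l.countP (m ≤ ·) := by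
  intro m
  have h := (isKth_getD_of_pairwise (List.pairwise_insertionSort (· ≤ ·) l) (k := 2)
    (by simp [hl]) z).perm (List.perm_insertionSort (· ≤ ·) l)
  refine ⟨h.2.2, ?_⟩
  have h2 := h.2.1
  have h3 := length_eq_countP_ge_add m l
  rw [hl] at h3
  have : l.countP (· < m) ≤ 2 := h2
  omega

/-- A group whose median lies on one side of p has at least three of its five elements on that side,
hence the factor 3. Sorting five elements takes at most 61 steps, so 13 steps per element suffice.
-/
theorem run_groupMedians : ∀ l : List ℝ,
    ((groupMedians l).run mem).1.length = l.length / 5 ∧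
    ((groupMedians l).run mem).2 ≤ 13 * l.length + 1 ∧
    ∀ p : ℝ, 3 * ((groupMedians l).run mem).1.countP (· ≤ p) ≤ l.countP (· ≤ p) ∧
      3 * ((groupMedians l).run mem).1.countP (p ≤ ·) ≤ l.countP (p ≤ ·)
  | a :: b :: c :: e :: f :: l => by
      obtain ⟨h1, h2, h3⟩ := run_groupMedians l
      have h4 := run_insertionSort_snd_le mem [a, b, c, e, f]
      obtain ⟨h5, h6⟩ := three_le_countP_insertionSort [a, b, c, e, f] rfl a
      simp only [groupMedians, run_bind_fst, run_bind_snd, run_pure, run_charge,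
        run_insertionSort_fst]
      set m := (List.insertionSort (· ≤ ·) [a, b, c, e, f]).getD 2 a with hm
      refine ⟨by simp [h1]; omega, by simp at h4 ⊢; omega, fun p => ⟨?_, ?_⟩⟩
      · have h7 := (h3 p).1
        have h8 : (a :: b :: c :: e :: f :: l) = [a, b, c, e, f] ++ l := rfl
        rw [h8, List.countP_append, List.countP_cons]
        split_ifs with h9
        · simp only [decide_eq_true_eq] at h9
          have := List.countP_mono_left (l := [a, b, c, e, f]) (p := fun x => decide (x ≤ m))
            (q := fun x => decide (x ≤ p)) (fun x _ hx => by
              simp only [decide_eq_true_eq] at hx ⊢; exact hx.trans h9)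
          omega
        · omega
      · have h7 := (h3 p).2
        have h8 : (a :: b :: c :: e :: f :: l) = [a, b, c, e, f] ++ l := rfl
        rw [h8, List.countP_append, List.countP_cons]
        split_ifs with h9
        · simp only [decide_eq_true_eq] at h9
          have := List.countP_mono_left (l := [a, b, c, e, f]) (p := fun x => decide (m ≤ x))
            (q := fun x => decide (p ≤ x)) (fun x _ hx => by
              simp only [decide_eq_true_eq] at hx ⊢; exact h9.trans hx)
          omega
        · omega
  | [] => by simp [groupMedians]
  | [_] => by simp [groupMedians]
  | [_, _] => by simp [groupMedians]
  | [_, _, _] => by simp [groupMedians]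
  | [_, _, _, _] => by simp [groupMedians]

/-! ### Selection in linear time -/

/-- The pivot is the middle one of about n/5 group medians, so about 3n/10 elements are at most p
and as many are at least p. The two recursive calls thus have total length about 9n/10, and the
remaining tenth of the budget, about 40n, pays for grouping and splitting. Lists of length at most
100 fit the budget by quadratic sorting. -/
theorem run_select (z : ℝ) : ∀ (fuel : ℕ) (xs : List ℝ) (k : ℕ), xs.length < fuel →
    k < xs.length → IsKth xs k ((select z fuel xs k).run mem).1 ∧
      ((select z fuel xs k).run mem).2 ≤ 400 * (xs.length + 1)
  | 0, _, _, h, _ => by omega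
  | fuel + 1, xs, k, hf, hk => by
      by_cases hs : xs.length ≤ 100
      · simp only [select, hs, if_true, run_bind_fst, run_bind_snd, run_charge, run_pure,
          run_insertionSort_fst, List.length_insertionSort]
        refine ⟨(isKth_getD_of_pairwise (List.pairwise_insertionSort (· ≤ ·) xs)
          (by simpa using hk) z).perm (List.perm_insertionSort (· ≤ ·) xs), ?_⟩
        have := run_insertionSort_snd_le mem xs
        nlinarith
      · obtain ⟨h1, h2, h3⟩ := run_groupMedians mem xs
        simp only [select, hs, if_false, run_bind_fst, run_bind_snd, run_charge, run_splitAt_fst,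
          ← List.countP_eq_length_filter]
        set ms := ((groupMedians xs).run mem).1 with hms
        obtain ⟨hp1, hp2⟩ := run_select z fuel ms (ms.length / 2) (by omega) (by omega)
        set p := ((select z fuel ms (ms.length / 2)).run mem).1 with hp
        have h4 := run_splitAt_snd_le mem p xs
        have h5 := length_eq_countP_le_add p xs
        have h6 := length_eq_countP_ge_add p xs
        have h7 := length_eq_countP_ge_add p ms
        have h8 := countP_le_eq p xs
        obtain ⟨h9, h10⟩ := h3 p
        obtain ⟨-, h11, h12⟩ := hp1
        have hlt : (xs.filter (· < p)).length = xs.countP (· < p) :=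
          List.countP_eq_length_filter.symm
        have hgt : (xs.filter (p < ·)).length = xs.countP (p < ·) :=
          List.countP_eq_length_filter.symm
        by_cases c1 : k < xs.countP (· < p)
        · rw [if_pos c1]
          obtain ⟨r1, r2⟩ := run_select z fuel (xs.filter (· < p)) k (by omega) (by omega)
          exact ⟨r1.of_filter_lt, by omega⟩
        · rw [if_neg c1]
          by_cases c2 : k < xs.countP (· < p) + xs.countP (· = p)
          · rw [if_pos c2]
            exact ⟨isKth_pivot (not_lt.1 c1) c2, by simp; omega⟩
          · rw [if_neg c2]
            obtain ⟨r1, r2⟩ := run_select z fuel (xs.filter (p < ·))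
              (k - xs.countP (· < p) - xs.countP (· = p)) (by omega) (by omega)
            rw [Nat.sub_sub, ← h8] at r1 r2 ⊢
            exact ⟨r1.of_filter_gt (by omega), by omega⟩

theorem isKth_sort {r : ℕ} (f : Fin r → ℝ) {k : ℕ} (hk : k < r) :
    IsKth (List.ofFn f) k ((Finset.univ.val.map f).sort.getD k 0) := by
  have h1 : (Finset.univ.val.map f) = (List.ofFn f : Multiset ℝ) := by
    rw [List.ofFn_eq_map, ← Multiset.map_coe, Fin.univ_val_map, List.ofFn_eq_map]; rfl
  refine (isKth_getD_of_pairwise (Multiset.pairwise_sort _ (· ≤ ·)) (k := k) ?_ 0).perm ?_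
  · simpa using hk
  · rw [← Multiset.coe_eq_coe, Multiset.sort_eq, h1]

theorem run_medianProg {r : ℕ} (hr : 0 < r) (t : Fin r → ℝ) :
    ((medianProg t).run mem).1 = median t ∧
      ((medianProg t).run mem).2 ≤ 801 * r + 806 := by
  obtain ⟨a1, a2⟩ := run_select mem 0 (r + 1) (List.ofFn t) ((r - 1) / 2) (by simp)
    (by simp; omega)
  obtain ⟨b1, b2⟩ := run_select mem 0 (r + 1) (List.ofFn t) (r / 2) (by simp)
    (by simp; omega)
  simp only [List.length_ofFn] at a2 b2
  simp only [medianProg, run_bind_fst, run_bind_snd, run_charge, run_constant, run_plus,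
    run_quotient, Nat.cast_zero, Nat.cast_ofNat]
  refine ⟨?_, by omega⟩
  rw [median, a1.unique (isKth_sort t (by omega)), b1.unique (isKth_sort t (by omega))]

end Select

end QuantileSampling

namespace QuantileSampling

/-! ### The sampling program -/

section Pattern

variable {n d : ℕ} (A : Matrix (Fin n) (Fin d) ℝ)

/-- Justifies skipping zeros, both for the entries within a row and, with an indicator as `a`, for
whole zero rows. -/
theorem sum_filter_ne_zero (a b : Fin d → ℝ) (h : ∀ j, a j = 0 → b j = 0) :
    (((List.finRange d).filter fun j => a j ≠ 0).map b).sum = ∑ j, b j := by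
  rw [← List.sum_ofFn, List.ofFn_eq_map]
  induction List.finRange d with
  | nil => rfl
  | cons j l ih =>
    by_cases hj : a j = 0
    · simp [hj, h j hj] at ih ⊢; exact ih
    · simp [hj] at ih ⊢; exact ih

theorem eq_of_mem_sparsityPattern {q : Fin n × List (Fin d)} (hq : q ∈ sparsityPattern A) :
    q.2 = (List.finRange d).filter fun j => A q.1 j ≠ 0 := by
  obtain ⟨h, -⟩ := List.mem_filter.1 hq
  obtain ⟨i, -, rfl⟩ := List.mem_map.1 h
  rfl

theorem length_pos_of_mem_sparsityPattern {q : Fin n × List (Fin d)}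
    (hq : q ∈ sparsityPattern A) : 1 ≤ q.2.length := by
  obtain ⟨-, h⟩ := List.mem_filter.1 hq
  simp only [ne_eq, decide_not, Bool.not_eq_eq_eq_not, Bool.not_true, decide_eq_false_iff_not] at h
  exact List.length_pos_iff.2 h

theorem map_fst_sparsityPattern : (sparsityPattern A).map Prod.fst =
    (List.finRange n).filter fun i => ∃ j, A i j ≠ 0 := by
  classical
  rw [sparsityPattern, List.filter_map, List.map_map]
  have : (Prod.fst ∘ fun i => (i, (List.finRange d).filter fun j => A i j ≠ 0)) = id := rfl
  rw [this, List.map_id]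
  apply List.filter_congr
  intro i _
  simp [← not_forall]

theorem sum_length_sparsityPattern :
    ((sparsityPattern A).map fun q => q.2.length).sum = nnz A := by
  have h1 : nnz A = ∑ i, ((List.finRange d).filter fun j => A i j ≠ 0).length := by
    rw [nnz, Finset.card_filter, ← Finset.univ_product_univ, Finset.sum_product]
    refine Finset.sum_congr rfl fun i _ => ?_
    rw [← Finset.card_filter]
    rfl
  rw [h1, ← List.sum_ofFn, List.ofFn_eq_map, sparsityPattern]
  induction List.finRange n with
  | nil => rfl
  | cons i l ih =>
    by_cases hi : (List.finRange d).filter (fun j => A i j ≠ 0) = []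
    · simp only [List.map_cons, List.sum_cons, hi, ne_eq, not_true_eq_false, decide_false,
        Bool.false_eq_true, not_false_eq_true, List.filter_cons_of_neg, List.length_nil, zero_add]
      exact ih
    · rw [List.map_cons, List.filter_cons_of_pos (by simpa using hi), List.map_cons, List.sum_cons,
        List.map_cons, List.sum_cons, ih]

theorem length_sparsityPattern_le : (sparsityPattern A).length ≤ nnz A := by
  rw [← sum_length_sparsityPattern]
  have := List.card_nsmul_le_sum ((sparsityPattern A).map fun q => q.2.length) 1 (by
    simp only [List.mem_map]
    rintro x ⟨q, hq, rfl⟩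
    exact length_pos_of_mem_sparsityPattern A hq)
  simpa using this

end Pattern

theorem median_zero {r : ℕ} : median (fun _ : Fin r => (0 : ℝ)) = 0 := by
  have h : ∀ k, ((Finset.univ.val.map fun _ : Fin r => (0 : ℝ)).sort).getD k 0 = 0 := by
    intro k
    by_cases hk : k < ((Finset.univ.val.map fun _ : Fin r => (0 : ℝ)).sort).length
    · rw [List.getD_eq_getElem _ _ hk]
      have := List.getElem_mem hk
      rw [Multiset.mem_sort, Multiset.mem_map] at this
      obtain ⟨_, -, h⟩ := this
      exact h.symm
    · exact List.getD_eq_default _ _ (not_lt.1 hk)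
  unfold median
  simp only [h]
  norm_num

/-- Hence a zero row adds nothing to the total and is never kept, so the program need not touch it.
-/
theorem rowEstimate_eq_zero {n d r : ℕ} {A : Matrix (Fin n) (Fin d) ℝ}
    (R : Matrix (Fin d) (Fin d) ℝ) (G : Matrix (Fin d) (Fin r) ℝ) {i : Fin n}
    (h : ∀ j, A i j = 0) : rowEstimate A R G i = 0 := by
  unfold rowEstimate
  have : (fun l => |(A * (R⁻¹ * G)) i l|) = fun _ => (0 : ℝ) := by
    ext l
    rw [Matrix.mul_apply]
    simp [h]
  rw [this, median_zero]

/-! ### Correctness and running time of the program -/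

section Program

variable {n d r : ℕ} (A : Matrix (Fin n) (Fin d) ℝ) (R : Matrix (Fin d) (Fin d) ℝ)
  (κ ε τ : ℝ) (ω : Seed n d r)

theorem run_sampleSizeProg :
    (sampleSizeProg : Comp (Cell n d r) ℝ ℝ).run (memory A R κ ε τ ω) =
      (sampleSize d κ ε τ, 21) := by
  ext
  · simp only [sampleSizeProg, run_bind_fst, run_readCell, run_constant, run_minus, run_quotient,
      run_times, run_logarithm, run_plus, memory, sampleSize, Nat.cast_one, Nat.cast_ofNat, pow_two]
  · simp [sampleSizeProg]

/-- Here `p` stands for "the row is nonzero" and `c` for "the coin succeeds". Since success forces a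
nonzero row and a nonzero weight, looping over the nonzero rows lists exactly the nonzero diagonal
entries. -/
theorem flatten_map_filter {α : Type} (L : List α) (p c : α → Prop) [DecidablePred p]
    [DecidablePred c] (w : α → ℝ) (hw : ∀ a, c a → w a ≠ 0) (hp : ∀ a, c a → p a) :
    ((L.filter p).map fun a => if c a then [(a, w a)] else []).flatten =
      (L.filter fun a => (if c a then w a else 0) ≠ 0).map
        fun a => (a, if c a then w a else 0) := by
  induction L with
  | nil => rfl
  | cons a L ih =>
    by_cases hc : c a
    · simp [hc, hp a hc, hw a hc] at ih ⊢; exact ih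
    · by_cases ha : p a <;> simp [hc, ha] at ih ⊢ <;> exact ih

variable {R κ ε τ ω} in
theorem pos_keepProb_of_lt {i : Fin n}
    (h : (ω.2 i : ℝ) < keepProb A R κ ε τ (Matrix.of ω.1) i) :
    0 < keepProb A R κ ε τ (Matrix.of ω.1) i := (ω.2 i).2.1.trans_lt h

theorem exists_ne_zero_of_keepProb_pos {G : Matrix (Fin d) (Fin r) ℝ} {i : Fin n}
    (h : 0 < keepProb A R κ ε τ G i) : ∃ j, A i j ≠ 0 := by
  by_contra! h'
  simp [keepProb, rowEstimate_eq_zero R _ h'] at h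

variable (hr : 0 < r)
include hr

/-- The summands of the step bound are the phases in order: drawing Π₂, forming R⁻¹Π₂, estimates,
their total, sample size, probabilities, coins, flattening. -/
theorem run_samplingProg :
    ((samplingProg (sparsityPattern A)).run (memory A R κ ε τ ω)).1 =
        diagonalList (samplingMatrix A R κ ε τ ω) ∧
      ((samplingProg (sparsityPattern A)).run (memory A R κ ε τ ω)).2 ≤
        (d * (2 * r + 2) + 1) + (d * (r * (4 * d + 2) + 2) + 1) +
        (1618 * r * nnz A + 1) + (2 * nnz A + 1) + 21 + (5 * nnz A + 1) + (5 * nnz A + 1)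
          + (nnz A + 1) := by
  classical
  set mem := memory A R κ ε τ ω with hmem
  set rows := sparsityPattern A with hrows
  have hlen : rows.length ≤ nnz A := length_sparsityPattern_le A
  -- the random matrix
  set progP : Comp (Cell n d r) ℝ (Fin d → Fin r → ℝ) :=
    tabulate d fun k => tabulate r fun l => readCell (.cauchy k l) with hP
  have hP1 : (progP.run mem).1 = ω.1 := by
    rw [hP, run_tabulate_fst]; ext k l; rw [run_tabulate_fst]; rfl
  have hP2 : (progP.run mem).2 ≤ d * (2 * r + 2) + 1 := by
    refine (run_tabulate_snd_le mem (r * 2 + 1) _ _ fun k => ?_).trans (le_of_eq (by ring))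
    exact run_tabulate_snd_le mem 1 _ _ fun l => le_of_eq rfl
  -- its product with the inverse
  set progG : Comp (Cell n d r) ℝ (Fin d → Fin r → ℝ) := tabulate d fun j => tabulate r fun l =>
    sumOver (fun k => do
      let x ← readCell (.inv j k)
      times x (ω.1 k l)) (List.finRange d) with hG
  have hG1 : (progG.run mem).1 = R⁻¹ * Matrix.of ω.1 := by
    rw [hG, run_tabulate_fst]; ext j l
    rw [run_tabulate_fst, Matrix.mul_apply, ← List.sum_ofFn, List.ofFn_eq_map]
    exact run_sumOver_fst mem _ _
  have hG2 : (progG.run mem).2 ≤ d * (r * (4 * d + 2) + 2) + 1 := by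
    refine (run_tabulate_snd_le mem (r * (4 * d + 2) + 1) _ _ fun k => ?_).trans (le_of_eq (by ring))
    refine run_tabulate_snd_le mem (4 * d + 1) _ _ fun l => ?_
    refine (run_sumOver_snd_le mem _ 2 (fun _ => ?_) _).trans (le_of_eq ?_)
    · simp
    · rw [List.length_finRange]; ring
  set G : Fin d → Fin r → ℝ := R⁻¹ * Matrix.of ω.1 with hGdef
  -- the estimates
  set progE : Comp (Cell n d r) ℝ (List (Fin n × ℝ)) := forEach (fun q => do
    let row ← tabulate r fun l => do
      let x ← sumOver (fun j => do
        let a ← readCell (.entry q.1 j)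
        times a (G j l)) q.2
      absValue x
    let m ← medianProg row
    pure (q.1, m)) rows with hE
  set lam : Fin n → ℝ := rowEstimate A R (Matrix.of ω.1) with hlam
  have hE1 : (progE.run mem).1 = (rows.map Prod.fst).map fun i => (i, lam i) := by
    rw [hE, run_forEach_fst, List.map_map]
    refine List.map_congr_left fun q hq => ?_
    simp only [run_bind_fst, run_pure, run_tabulate_fst, (run_medianProg mem hr _).1,
      Function.comp_apply, run_absValue_fst, run_sumOver_fst, run_readCell, run_times]
    congr 2
    ext l
    rw [eq_of_mem_sparsityPattern A hq, sum_filter_ne_zero (A q.1) _ ?_, Matrix.mul_apply]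
    · rfl
    · intro j hj
      change A q.1 j * _ = 0
      rw [hj, zero_mul]
  have hE2 : (progE.run mem).2 ≤ 1618 * r * nnz A + 1 := by
    rw [hE, run_forEach_snd, ← sum_length_sparsityPattern, ← List.sum_map_mul_left]
    refine Nat.add_le_add_right (List.sum_le_sum fun q hq => ?_) 1
    have hq1 := length_pos_of_mem_sparsityPattern A hq
    simp only [run_bind_snd, run_pure]
    have h1 := (run_medianProg mem hr ((tabulate r fun l => do
      let x ← sumOver (fun j => do
        let a ← readCell (.entry q.1 j)
        times a (G j l)) q.2
      absValue x).run mem).1).2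
    have h2 : ((tabulate r fun l => do
      let x ← sumOver (fun j => do
        let a ← readCell (.entry q.1 j)
        times a (G j l)) q.2
      absValue x).run mem).2 ≤ r * (4 * q.2.length + 4 + 1) + 1 := by
      refine run_tabulate_snd_le mem _ _ _ fun l => ?_
      rw [run_bind_snd]
      have h3 := run_sumOver_snd_le mem (fun j => do
        let a ← readCell (.entry q.1 j)
        times a (G j l)) 2 (fun _ => by simp) q.2
      refine (Nat.add_le_add h3 (run_absValue_snd_le mem _)).trans (le_of_eq (by ring))
    -- A row with m nonzero entries costs at most 4rm + 806r + 808 steps; as r, m ≥ 1 this is at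
    -- most (4 + 806 + 808) rm = 1618 rm.
    have h4 : r ≤ r * q.2.length := Nat.le_mul_of_pos_right _ hq1
    have h5 : 1 ≤ r * q.2.length := Nat.mul_pos hr hq1
    nlinarith
  -- their sum
  set est : List (Fin n × ℝ) := (rows.map Prod.fst).map fun i => (i, lam i) with hest
  have hestlen : est.length = rows.length := by simp [hest]
  set progT : Comp (Cell n d r) ℝ ℝ := sumOver (fun e => pure e.2) est with hT
  have hT1 : (progT.run mem).1 = ∑ k, lam k := by
    rw [hT, run_sumOver_fst, hest, List.map_map, hrows, map_fst_sparsityPattern]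
    -- The indicator of the nonzero rows plays the role of the vector whose zeros are skipped.
    have h := sum_filter_ne_zero (d := n) (fun i => if ∃ j, A i j ≠ 0 then 1 else 0) lam ?_
    · rw [← h]
      congr 2
      apply List.filter_congr
      intro i _
      simp
    · intro i hi
      refine rowEstimate_eq_zero R _ ?_
      simpa using hi
  have hT2 : (progT.run mem).2 ≤ 2 * nnz A + 1 := by
    have h := run_sumOver_snd_le mem (fun e : Fin n × ℝ => (pure e.2 : Comp (Cell n d r) ℝ ℝ)) 0
      (fun _ => le_of_eq rfl) est
    change (progT.run mem).2 ≤ _ at h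
    omega
  -- the probabilities
  set progQ : Comp (Cell n d r) ℝ (List (Fin n × ℝ)) := forEach (fun e => do
    let x ← quotient e.2 (∑ k, lam k)
    let y ← times (sampleSize d κ ε τ) x
    let p ← minOne y
    pure (e.1, p)) est with hQ
  set pr : Fin n → ℝ := keepProb A R κ ε τ (Matrix.of ω.1) with hpr
  have hQ1 : (progQ.run mem).1 = (rows.map Prod.fst).map fun i => (i, pr i) := by
    rw [hQ, run_forEach_fst, hest, List.map_map]
    refine List.map_congr_left fun i _ => ?_
    simp [run_minOne_fst, hpr, keepProb, hlam]
  have hQ2 : (progQ.run mem).2 ≤ 5 * nnz A + 1 := by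
    rw [hQ, run_forEach_snd]
    have h := List.sum_le_card_nsmul (est.map fun e => ((do
      let x ← quotient e.2 (∑ k, lam k)
      let y ← times (sampleSize d κ ε τ) x
      let p ← minOne y
      pure (e.1, p) : Comp (Cell n d r) ℝ (Fin n × ℝ)).run mem).2 + 1) 5 (by
        simp only [List.mem_map]
        rintro x ⟨e, -, rfl⟩
        simp only [run_bind_snd, run_quotient, run_times, run_pure]
        have := run_minOne_snd_le mem (sampleSize d κ ε τ * (e.2 / ∑ k, lam k))
        omega)
    rw [List.length_map, smul_eq_mul] at h
    omega
  -- the coins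
  set prob : List (Fin n × ℝ) := (rows.map Prod.fst).map fun i => (i, pr i) with hprob
  have hproblen : prob.length = rows.length := by simp [hprob]
  set progO : Comp (Cell n d r) ℝ (List (List (Fin n × ℝ))) := forEach (fun e => do
    let u ← readCell (.coin e.1)
    let b ← isLess u e.2
    if b then do
      let one ← constant 1
      let w ← quotient one e.2
      pure [(e.1, w)]
    else pure []) prob with hO
  have hO1 : (progO.run mem).1.flatten = diagonalList (samplingMatrix A R κ ε τ ω) := by
    rw [hO, run_forEach_fst, hprob, List.map_map, hrows, map_fst_sparsityPattern]
    have h := flatten_map_filter (List.finRange n) (fun i => ∃ j, A i j ≠ 0)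
      (fun i => (ω.2 i : ℝ) < pr i) (fun i => 1 / pr i)
      (fun i hi => (one_div_pos.2 (pos_keepProb_of_lt A hi)).ne')
      (fun i hi => exists_ne_zero_of_keepProb_pos A R κ ε τ (pos_keepProb_of_lt A hi))
    simp only [diagonalList, samplingMatrix, Matrix.diagonal_apply_eq]
    rw [← hpr, ← h]
    congr 1
    refine List.map_congr_left fun i _ => ?_
    simp only [Function.comp_apply, run_bind_fst, run_readCell, run_isLess]
    have : mem (.coin i) = (ω.2 i : ℝ) := rfl
    rw [this]
    by_cases hi : (ω.2 i : ℝ) < pr i <;> simp [hi]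
  have hO2 : (progO.run mem).2 ≤ 5 * nnz A + 1 := by
    rw [hO, run_forEach_snd]
    have h := List.sum_le_card_nsmul (prob.map fun e => ((do
      let u ← readCell (.coin e.1)
      let b ← isLess u e.2
      if b then do
        let one ← constant 1
        let w ← quotient one e.2
        pure [(e.1, w)]
      else pure [] : Comp (Cell n d r) ℝ (List (Fin n × ℝ))).run mem).2 + 1) 5 (by
        simp only [List.mem_map]
        rintro x ⟨e, -, rfl⟩
        by_cases he : mem (.coin e.1) < e.2 <;> simp [he])
    rw [List.length_map, smul_eq_mul] at h
    omega
  have hOlen : (progO.run mem).1.length ≤ nnz A := by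
    rw [hO, run_forEach_fst, List.length_map]; omega
  have hS : ((sampleSizeProg : Comp (Cell n d r) ℝ ℝ).run mem) = (sampleSize d κ ε τ, 21) :=
    run_sampleSizeProg A R κ ε τ ω
  have hfst : ((samplingProg rows).run mem).1 = (progO.run mem).1.flatten := by
    unfold samplingProg
    simp only [run_bind_fst, run_pure, ← hP, hP1, ← hG, hG1, ← hE, hE1, ← hT, hT1, hS, ← hQ, hQ1,
      ← hO]
  have hsnd : ((samplingProg rows).run mem).2 = (progP.run mem).2 + ((progG.run mem).2 +
      ((progE.run mem).2 + ((progT.run mem).2 + (21 + ((progQ.run mem).2 +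
        ((progO.run mem).2 + ((progO.run mem).1.length + 1))))))) := by
    unfold samplingProg
    simp only [run_bind_snd, run_charge, run_pure, ← hP, hP1, ← hG, hG1, ← hE, hE1, ← hT, hT1, hS,
      ← hQ, hQ1, ← hO, add_zero]
  refine ⟨hfst.trans hO1, ?_⟩
  rw [hsnd]
  omega

theorem execute_fst : (execute A R κ ε τ ω).1 = diagonalList (samplingMatrix A R κ ε τ ω) :=
  (run_samplingProg A R κ ε τ ω hr).1

theorem execute_snd_le (hd : 0 < d) :
    (execute A R κ ε τ ω).2 ≤ 2000 * (r * (nnz A + d ^ 2)) := by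
  refine (run_samplingProg A R κ ε τ ω hr).2.trans ?_
  have h1 : d ≤ d ^ 2 := Nat.le_self_pow (by norm_num) d
  have h2 : d ^ 2 ≤ r * d ^ 2 := Nat.le_mul_of_pos_left _ hr
  have h3 : r * d ≤ r * d ^ 2 := Nat.mul_le_mul_left r h1
  have h4 : nnz A ≤ r * nnz A := Nat.le_mul_of_pos_left _ hr
  have h5 : 1 ≤ r * d ^ 2 := Nat.mul_pos hr (by positivity)
  nlinarith

end Program

theorem numProj_pos {n : ℕ} (hn : 0 < n) : 0 < numProj n := by
  apply Nat.ceil_pos.2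
  have : (1 : ℝ) ≤ n := by exact_mod_cast hn
  have := Real.log_pos (show (1 : ℝ) < 40 * n by linarith)
  positivity

/-- For n ≥ 2, log 40 ≤ 6 log n gives 15 · 7 = 105, and rounding up adds at most 1 ≤ 2 log n. -/
theorem numProj_le {n : ℕ} (hn : 2 ≤ n) : (numProj n : ℝ) ≤ 107 * Real.log n := by
  have h2 : (2 : ℝ) ≤ n := by exact_mod_cast hn
  have hl2 : Real.log 2 ≤ Real.log n := Real.log_le_log (by norm_num) h2
  have h40 : Real.log 40 ≤ 6 * Real.log n := by
    calc Real.log 40 ≤ Real.log (2 ^ 6) := Real.log_le_log (by norm_num) (by norm_num)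
      _ = 6 * Real.log 2 := by rw [Real.log_pow]; norm_num
      _ ≤ _ := by linarith
  have h := Real.log_two_gt_d9
  have hm : Real.log (40 * n) = Real.log 40 + Real.log n :=
    Real.log_mul (by norm_num) (by positivity)
  have hp : 0 ≤ 15 * Real.log (40 * n) := by
    rw [hm]
    have := Real.log_pos (show (1 : ℝ) < 40 by norm_num)
    linarith
  have := (Nat.ceil_lt_add_one hp).le
  rw [numProj]
  linarith

end QuantileSampling

namespace QuantileSampling

/-! ### The Cauchy distribution -/

section Cauchy

open Complex FourierTransform

theorem eqOn_laplace_Iic (w : ℝ) : Set.EqOn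
    (fun x : ℝ => cexp (↑(-2 * Real.pi * x * w) * I) • cexp (-|x|))
    (fun x : ℝ => cexp ((1 - 2 * Real.pi * w * I) * x)) (Set.Iic 0) := by
  intro x hx
  simp only [smul_eq_mul, ← Complex.exp_add]
  rw [abs_of_nonpos hx]
  congr 1
  push_cast; ring

theorem eqOn_laplace_Ioi (w : ℝ) : Set.EqOn
    (fun x : ℝ => cexp (↑(-2 * Real.pi * x * w) * I) • cexp (-|x|))
    (fun x : ℝ => cexp ((-1 - 2 * Real.pi * w * I) * x)) (Set.Ioi 0) := by
  intro x hx
  simp only [smul_eq_mul, ← Complex.exp_add]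
  rw [abs_of_pos hx]
  congr 1
  push_cast; ring

/-- The Fourier transform of `x ↦ exp (-|x|)`. -/
theorem fourier_exp_neg_abs (w : ℝ) :
    𝓕 (fun x : ℝ => cexp (-|x|)) w = ((2 / (1 + (2 * Real.pi * w) ^ 2) : ℝ) : ℂ) := by
  have h1 : 0 < (1 - 2 * Real.pi * w * I : ℂ).re := by simp
  have h2 : (-1 - 2 * Real.pi * w * I : ℂ).re < 0 := by simp
  rw [Real.fourier_real_eq_integral_exp_smul,
    ← intervalIntegral.integral_Iic_add_Ioi (b := 0)
      ((integrableOn_congr_fun (eqOn_laplace_Iic w) measurableSet_Iic).2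
        (integrableOn_exp_mul_complex_Iic h1 0))
      ((integrableOn_congr_fun (eqOn_laplace_Ioi w) measurableSet_Ioi).2
        (integrableOn_exp_mul_complex_Ioi h2 0)),
    setIntegral_congr_fun measurableSet_Iic (eqOn_laplace_Iic w),
    setIntegral_congr_fun measurableSet_Ioi (eqOn_laplace_Ioi w),
    integral_exp_mul_complex_Iic h1, integral_exp_mul_complex_Ioi h2]
  have h3 : (1 - 2 * Real.pi * w * I : ℂ) ≠ 0 := fun h => by rw [h] at h1; simp at h1
  have h4 : (-1 - 2 * Real.pi * w * I : ℂ) ≠ 0 := fun h => by rw [h] at h2; simp at h2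
  push_cast
  simp only [mul_zero, Complex.exp_zero]
  generalize (2 * Real.pi * w : ℂ) = x at h3 h4
  have h5 : (1 + x ^ 2 : ℂ) = -((1 - x * I) * (-1 - x * I)) := by ring_nf; simp only [I_sq]; ring
  rw [h5]
  field_simp
  ring

theorem integrable_exp_neg_abs : Integrable (fun x : ℝ => cexp (-|x|)) := by
  have h1 : 0 < (1 : ℂ).re := by simp
  have h2 : (-1 : ℂ).re < 0 := by simp
  rw [← integrableOn_univ, ← Set.Iic_union_Ioi (a := (0 : ℝ))]
  refine IntegrableOn.union ?_ ?_
  · refine (integrableOn_congr_fun (fun x hx => ?_) measurableSet_Iic).2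
      (integrableOn_exp_mul_complex_Iic h1 0)
    simp [abs_of_nonpos (show x ≤ 0 from hx)]
  · refine (integrableOn_congr_fun (fun x hx => ?_) measurableSet_Ioi).2
      (integrableOn_exp_mul_complex_Ioi h2 0)
    simp [abs_of_pos (show 0 < x from hx)]

theorem integrable_fourier_exp_neg_abs :
    Integrable (fun w : ℝ => ((2 / (1 + (2 * Real.pi * w) ^ 2) : ℝ) : ℂ)) := by
  have h := (integrable_inv_one_add_sq.comp_mul_left' (R := 2 * Real.pi) (by positivity)).const_mul 2
  simpa [div_eq_mul_inv] using h.ofReal (𝕜 := ℂ)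

/-- The characteristic function of the standard Cauchy distribution. -/
theorem charFun_cauchyMeasure (t : ℝ) : charFun (cauchyMeasure 0 1) t = Real.exp (-|t|) := by
  have hF : 𝓕 (fun x : ℝ => cexp (-|x|)) =
      fun w : ℝ => ((2 / (1 + (2 * Real.pi * w) ^ 2) : ℝ) : ℂ) := funext fourier_exp_neg_abs
  -- Fourier inversion for exp(-|x|), whose transform is the Cauchy density up to the substitution y
  -- = 2πw.
  have h := congrFun (Continuous.fourierInv_fourier_eq
    (f := fun x : ℝ => cexp (-|x|)) (by fun_prop) integrable_exp_neg_abs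
    (by rw [hF]; exact integrable_fourier_exp_neg_abs)) t
  rw [hF, Real.fourierInv_eq'] at h
  push_cast
  rw [← h, charFun_apply_real, cauchyMeasure_of_scale_ne_zero 0 one_ne_zero]
  rw [integral_withDensity_eq_integral_toReal_smul (by fun_prop) (by simp [cauchyPDF])]
  have h2 := Measure.integral_comp_mul_left (fun y : ℝ =>
    (cauchyPDF 0 1 y).toReal • cexp (t * y * I)) (2 * Real.pi)
  rw [abs_of_pos (by positivity), eq_inv_smul_iff₀ (by positivity), ← integral_smul] at h2
  rw [← h2]
  refine integral_congr_ae (ae_of_all _ fun w => ?_)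
  simp only [cauchyPDF, cauchyPDFReal, real_smul, smul_eq_mul, RCLike.inner_apply, conj_trivial]
  rw [ENNReal.toReal_ofReal (by positivity), mul_comm (cexp _), ← mul_assoc]
  congr 1
  · norm_cast
    have := Real.pi_pos
    field_simp
    ring
  · congr 1
    push_cast; ring

/-- A linear combination of independent Cauchy vectors has the law of a multiple of a Cauchy
vector. -/
theorem map_sum_mul_pi_cauchyMeasure {d r : ℕ} (u : Fin d → ℝ) :
    (Measure.pi fun _ : Fin d => Measure.pi fun _ : Fin r => cauchyMeasure 0 1).map
        (fun G l => ∑ k, u k * G k l) =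
      (Measure.pi fun _ : Fin r => cauchyMeasure 0 1).map (fun x l => (∑ k, |u k|) * x l) := by
  have hm1 : Measurable (fun (G : Fin d → Fin r → ℝ) l => ∑ k, u k * G k l) := by fun_prop
  have hm2 : Measurable (fun (x : Fin r → ℝ) l => (∑ k, |u k|) * x l) := by fun_prop
  have := Measure.isProbabilityMeasure_map (μ := Measure.pi fun _ : Fin d =>
    Measure.pi fun _ : Fin r => cauchyMeasure 0 1) hm1.aemeasurable
  have := Measure.isProbabilityMeasure_map (μ := Measure.pi fun _ : Fin r =>
    cauchyMeasure 0 1) hm2.aemeasurable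
  -- Both characteristic functions factor over the independent entries. At a functional with
  -- coordinates L_l the two values are exp(-Σ_l Σ_k |L_l u_k|) and exp(-Σ_l |L_l| Σ_k |u_k|).
  apply Measure.ext_of_charFunDual
  ext L
  have hL : ∀ x : Fin r → ℝ, L x = ∑ l, L (Pi.single l 1) * x l := by
    intro x
    conv_lhs => rw [pi_eq_sum_univ' x]
    simp [mul_comm]
  have hc : ∀ t : ℝ, ∫ x : ℝ, cexp ((t * x : ℝ) * I) ∂(cauchyMeasure 0 1) =
      Real.exp (-|t|) := by
    intro t
    rw [← charFun_cauchyMeasure, charFun_apply_real]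
    push_cast; rfl
  rw [charFunDual_apply, charFunDual_apply, integral_map hm1.aemeasurable (by fun_prop),
    integral_map hm2.aemeasurable (by fun_prop)]
  have e1 : ∀ G : Fin d → Fin r → ℝ, cexp (L (fun l => ∑ k, u k * G k l) * I) =
      ∏ k, ∏ l, cexp ((L (Pi.single l 1) * u k * G k l : ℝ) * I) := by
    intro G
    simp_rw [← Complex.exp_sum]
    rw [hL, Finset.sum_comm]
    push_cast
    rw [Finset.sum_mul]
    simp_rw [Finset.mul_sum, Finset.sum_mul, mul_assoc]
  have e2 : ∀ x : Fin r → ℝ, cexp (L (fun l => (∑ k, |u k|) * x l) * I) =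
      ∏ l, cexp ((L (Pi.single l 1) * (∑ k, |u k|) * x l : ℝ) * I) := by
    intro G
    rw [← Complex.exp_sum, hL]
    push_cast
    rw [Finset.sum_mul]
    simp_rw [mul_assoc]
  simp_rw [e1, e2]
  rw [integral_fintype_prod_eq_prod (f := fun k (g : Fin r → ℝ) =>
    ∏ l, cexp ((L (Pi.single l 1) * u k * g l : ℝ) * I))]
  simp_rw [fun k => integral_fintype_prod_eq_prod (μ := fun _ : Fin r => cauchyMeasure 0 1)
    (f := fun l (g : ℝ) => cexp ((L (Pi.single l 1) * u k * g : ℝ) * I))]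
  rw [integral_fintype_prod_eq_prod (μ := fun _ : Fin r => cauchyMeasure 0 1)
    (f := fun l (g : ℝ) => cexp ((L (Pi.single l 1) * (∑ k, |u k|) * g : ℝ) * I))]
  simp_rw [hc]
  norm_cast
  simp_rw [← Real.exp_sum]
  congr 1
  rw [Finset.sum_comm]
  refine Finset.sum_congr rfl fun l _ => ?_
  rw [abs_mul, abs_of_nonneg (Finset.sum_nonneg fun k _ => abs_nonneg (u k)), Finset.mul_sum,
    Finset.sum_neg_distrib]
  simp_rw [abs_mul]

end Cauchy

/-- The standard Cauchy distribution gives small intervals around `0` little mass. -/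
theorem cauchyMeasure_abs_lt_le {a : ℝ} (ha : 0 ≤ a) :
    (cauchyMeasure 0 1).real {x | |x| < a} ≤ 2 * a / Real.pi := by
  have hs : {x : ℝ | |x| < a} = Set.Ioo (-a) a := by ext x; simp [abs_lt]
  refine ENNReal.toReal_le_of_le_ofReal (by positivity) ?_
  rw [hs, cauchyMeasure_of_scale_ne_zero 0 one_ne_zero, withDensity_apply _ measurableSet_Ioo]
  calc ∫⁻ x in Set.Ioo (-a) a, cauchyPDF 0 1 x
      ≤ ∫⁻ x in Set.Ioo (-a) a, ENNReal.ofReal (Real.pi⁻¹) := by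
        refine lintegral_mono fun x => ENNReal.ofReal_le_ofReal ?_
        simp only [cauchyPDFReal, NNReal.coe_one, sub_zero, mul_one, one_pow]
        refine mul_le_of_le_one_right (by positivity) (inv_le_one_of_one_le₀ (by nlinarith [sq_nonneg x]))
    _ = ENNReal.ofReal (2 * a / Real.pi) := by
        rw [setLIntegral_const, Real.volume_Ioo, ← ENNReal.ofReal_mul (by positivity)]
        congr 1; field_simp; ring

/-- The standard Cauchy distribution gives the complement of large intervals around `0` little
mass. -/
theorem cauchyMeasure_lt_abs_le {b : ℝ} (hb : 0 < b) :
    (cauchyMeasure 0 1).real {x | b < |x|} ≤ 2 / (b * Real.pi) := by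
  have hs : {x : ℝ | b < |x|} = Set.Iio (-b) ∪ Set.Ioi b := by
    ext x; simp [lt_abs, or_comm, lt_neg]
  -- The density is at most 1/(π x²); the other tail follows by symmetry.
  have key : ∫⁻ x in Set.Ioi b, cauchyPDF 0 1 x ≤ ENNReal.ofReal (1 / (b * Real.pi)) := by
    have hint : IntegrableOn (fun x : ℝ => Real.pi⁻¹ * x ^ (-2 : ℝ)) (Set.Ioi b) :=
      (integrableOn_Ioi_rpow_of_lt (by norm_num) hb).const_mul _
    calc ∫⁻ x in Set.Ioi b, cauchyPDF 0 1 x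
        ≤ ∫⁻ x in Set.Ioi b, ENNReal.ofReal (Real.pi⁻¹ * x ^ (-2 : ℝ)) := by
          refine setLIntegral_mono' measurableSet_Ioi fun x hx => ENNReal.ofReal_le_ofReal ?_
          have hx0 : 0 < x := hb.trans hx
          simp only [cauchyPDFReal, NNReal.coe_one, sub_zero, mul_one, one_pow]
          rw [Real.rpow_neg hx0.le]
          norm_cast
          gcongr
          linarith
      _ = ENNReal.ofReal (∫ x in Set.Ioi b, Real.pi⁻¹ * x ^ (-2 : ℝ)) := by
          rw [ofReal_integral_eq_lintegral_ofReal hint]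
          refine (ae_restrict_iff' measurableSet_Ioi).2 (ae_of_all _ fun x hx => ?_)
          have hx0 : 0 < x := hb.trans hx
          positivity
      _ = ENNReal.ofReal (1 / (b * Real.pi)) := by
          rw [integral_const_mul, integral_Ioi_rpow_of_lt (by norm_num) hb]
          congr 1
          norm_num [Real.rpow_neg_one]
  have hneg : ∫⁻ x in Set.Iio (-b), cauchyPDF 0 1 x = ∫⁻ x in Set.Ioi b, cauchyPDF 0 1 x := by
    have h := (Measure.measurePreserving_neg (volume : Measure ℝ)).setLIntegral_comp_preimage_emb
      (MeasurableEquiv.neg ℝ).measurableEmbedding (cauchyPDF 0 1) (Set.Ioi b)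
    rw [← h]
    simp [cauchyPDF, cauchyPDFReal]
  refine ENNReal.toReal_le_of_le_ofReal (by positivity) ?_
  rw [hs, cauchyMeasure_of_scale_ne_zero 0 one_ne_zero,
    withDensity_apply _ (measurableSet_Iio.union measurableSet_Ioi)]
  refine (lintegral_union_le _ _ _).trans ?_
  rw [hneg]
  refine (add_le_add key key).trans (le_of_eq ?_)
  rw [← ENNReal.ofReal_add (by positivity) (by positivity)]
  congr 1; ring

end QuantileSampling

namespace QuantileSampling

/-! ### Medians of random vectors -/

theorem countP_ofFn {α : Type} {r : ℕ} (f : Fin r → α) (p : α → Prop) [DecidablePred p] :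
    (List.ofFn f).countP (fun x => p x) = (Finset.univ.filter fun i => p (f i)).card := by
  rw [List.ofFn_eq_map, List.countP_map, List.countP_eq_length_filter]
  rfl

theorem IsKth.lt_countP {xs : List ℝ} {k : ℕ} {x y : ℝ} (h : IsKth xs k x) (hxy : x < y) :
    k < xs.countP (· < y) :=
  h.2.2.trans_le (List.countP_mono_left fun z _ hz => by
    simp only [decide_eq_true_eq] at hz ⊢; exact hz.trans_lt hxy)

theorem IsKth.countP_le {xs : List ℝ} {k : ℕ} {x y : ℝ} (h : IsKth xs k x) (hxy : y ≤ x) :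
    xs.countP (· < y) ≤ k :=
  le_trans (List.countP_mono_left fun z _ hz => by
    simp only [decide_eq_true_eq] at hz ⊢; exact hz.trans_le hxy) h.2.1

theorem IsKth.le {xs : List ℝ} {k l : ℕ} {x y : ℝ} (hx : IsKth xs k x) (hy : IsKth xs l y)
    (h : k ≤ l) : x ≤ y := by
  by_contra! hlt
  have := hy.lt_countP hlt
  have := hx.countP_le le_rfl
  omega

section Median

variable {r : ℕ} (hr : 0 < r)
include hr

/-- The smaller of the two middle order statistics is at most their average, so it lies below a, and
more than (r-1)/2 entries do. -/
theorem le_card_of_median_lt {f : Fin r → ℝ} {a : ℝ} (h : median f < a) :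
    r ≤ 2 * (Finset.univ.filter fun l => f l < a).card := by
  have hx := isKth_sort f (k := (r - 1) / 2) (by omega)
  have hy := isKth_sort f (k := r / 2) (by omega)
  have hxy := hx.le hy (by omega)
  have := hx.lt_countP (y := a) (by simp only [median] at h; linarith)
  rw [countP_ofFn f (· < a)] at this
  omega

theorem le_card_of_lt_median {f : Fin r → ℝ} {b : ℝ} (h : b < median f) :
    r ≤ 2 * (Finset.univ.filter fun l => b < f l).card := by
  have hx := isKth_sort f (k := (r - 1) / 2) (by omega)
  have hy := isKth_sort f (k := r / 2) (by omega)
  have hxy := hx.le hy (by omega)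
  have hb : b < (Finset.univ.val.map f).sort.getD (r / 2) 0 := by
    simp only [median] at h; linarith
  have h1 := hy.countP_le le_rfl
  have h2 := length_eq_countP_ge_add ((Finset.univ.val.map f).sort.getD (r / 2) 0) (List.ofFn f)
  have h3 : (List.ofFn f).countP ((Finset.univ.val.map f).sort.getD (r / 2) 0 ≤ ·) ≤
      (List.ofFn f).countP (b < ·) := List.countP_mono_left fun z _ hz => by
    simp only [decide_eq_true_eq] at hz ⊢; exact hb.trans_le hz
  rw [countP_ofFn f (b < ·)] at h3
  rw [List.length_ofFn] at h2
  omega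

/-- The k-th order statistic is less than x exactly when more than k coordinates are. -/
theorem measurable_median : Measurable (median : (Fin r → ℝ) → ℝ) := by
  have key : ∀ k < r, Measurable fun f : Fin r → ℝ => (Finset.univ.val.map f).sort.getD k 0 := by
    intro k hk
    refine measurable_of_Iio fun x => ?_
    have : (fun f : Fin r → ℝ => (Finset.univ.val.map f).sort.getD k 0) ⁻¹' Set.Iio x =
        {f | k < ∑ i, if f i < x then 1 else 0} := by
      ext f
      have h := isKth_sort f hk
      simp only [Set.mem_preimage, Set.mem_Iio, Set.mem_ofPred_eq, ← Finset.card_filter]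
      rw [← countP_ofFn f (· < x)]
      exact ⟨h.lt_countP, fun h' => by
        by_contra! hle
        exact absurd (h.countP_le hle) (by omega)⟩
    rw [this]
    refine measurableSet_lt measurable_const (Finset.measurable_sum _ fun i _ => ?_)
    exact Measurable.ite (measurableSet_lt (measurable_pi_apply i) measurable_const)
      measurable_const measurable_const
  unfold median
  exact ((key _ (by omega)).add (key _ (by omega))).div_const 2

theorem measurable_keepProb {n d : ℕ} (A : Matrix (Fin n) (Fin d) ℝ)
    (R : Matrix (Fin d) (Fin d) ℝ) (κ ε τ : ℝ) (i : Fin n) :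
    Measurable fun G : Fin d → Fin r → ℝ => keepProb A R κ ε τ (Matrix.of G) i := by
  have h : ∀ i, Measurable fun G : Fin d → Fin r → ℝ => rowEstimate A R (Matrix.of G) i := by
    intro i
    refine (measurable_median hr).comp (measurable_pi_lambda _ fun l => ?_)
    refine Measurable.abs ?_
    simp only [← Matrix.mul_assoc]
    simp only [Matrix.mul_apply (M := A * R⁻¹), Matrix.of_apply]
    fun_prop
  unfold keepProb
  have h' : Measurable fun G : Fin d → Fin r → ℝ => ∑ k, rowEstimate A R (Matrix.of G) k :=
    Finset.measurable_sum _ fun k _ => h k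
  exact measurable_const.min (((h i).div h').const_mul _)

end Median

/-- A Chernoff bound: it is unlikely that half of the coordinates fall in a small set. -/
theorem pi_real_half_card_le {r : ℕ} {ν : Measure ℝ} [IsProbabilityMeasure ν] {p : ℝ}
    {P : ℝ → Prop} [DecidablePred P] (hP : MeasurableSet {x | P x}) (hp : ν.real {x | P x} ≤ p) :
    (Measure.pi fun _ : Fin r => ν).real
      {x | r ≤ 2 * (Finset.univ.filter fun l => P (x l)).card} ≤ ((1 + 3 * p) / 2) ^ r := by
  -- Markov's inequality for the product of 4^(indicator of P): each factor has mean 1 + 3ν(P), and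
  -- the product is at least 4^(r/2) = 2^r when half of the coordinates satisfy P.
  set g : ℝ → ℝ := fun x => if P x then 4 else 1 with hg
  have hgi : g = fun x => 1 + {x | P x}.indicator (fun _ => (3 : ℝ)) x := by
    ext x
    by_cases h : P x <;> simp [hg, h]; norm_num
  have hint : Integrable ({x | P x}.indicator (fun _ => (3 : ℝ))) ν :=
    (integrable_const _).indicator hP
  have hgint : Integrable g ν := by rw [hgi]; exact (integrable_const _).add hint
  have hgE : ∫ x, g x ∂ν = 1 + 3 * ν.real {x | P x} := by
    rw [hgi, integral_add (integrable_const _) hint, integral_indicator hP]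
    simp [mul_comm]
  have hprod : ∀ x : Fin r → ℝ, ∏ l, g (x l) =
      4 ^ (Finset.univ.filter fun l => P (x l)).card := by
    intro x
    rw [Finset.prod_ite]; simp
  have hg0 : ∀ x, 0 ≤ g x := fun x => by
    by_cases h : P x <;> simp [hg, h]
  have hM := mul_meas_ge_le_integral_of_nonneg (μ := Measure.pi fun _ : Fin r => ν)
    (f := fun x => ∏ l, g (x l)) (ae_of_all _ fun x => Finset.prod_nonneg fun l _ => hg0 _)
    (Integrable.fintype_prod fun _ => hgint) (2 ^ r)
  rw [integral_fintype_prod_eq_prod (f := fun (_ : Fin r) x => g x)] at hM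
  simp only [hgE, Finset.prod_const, Finset.card_univ, Fintype.card_fin] at hM
  have hsub : {x : Fin r → ℝ | r ≤ 2 * (Finset.univ.filter fun l => P (x l)).card} ⊆
      {x | 2 ^ r ≤ ∏ l, g (x l)} := by
    intro x hx
    simp only [Set.mem_ofPred_eq, hprod] at hx ⊢
    calc (2 : ℝ) ^ r ≤ 2 ^ (2 * (Finset.univ.filter fun l => P (x l)).card) :=
          pow_le_pow_right₀ (by norm_num) hx
      _ = _ := by rw [pow_mul]; norm_num
  have h1 := measureReal_mono (μ := Measure.pi fun _ : Fin r => ν) hsub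
  have h2 : (1 + 3 * ν.real {x | P x}) ^ r ≤ (1 + 3 * p) ^ r := by gcongr
  rw [div_pow, le_div_iff₀ (by positivity), mul_comm]
  have h3 : (2 : ℝ) ^ r * _ ≤ 2 ^ r * _ := mul_le_mul_of_nonneg_left h1 (by positivity)
  linarith

/-- The value 9/(10π) is the tail bound of both thresholds 9/20 and 20/9. It gives (1 + 3p)/2 < 1 -
1/15 ≤ exp(-1/15), and r ≥ 15 log(40n) finishes. -/
theorem pow_numProj_le {n : ℕ} (hn : 0 < n) {p : ℝ} (hp0 : 0 ≤ p) (hp : p ≤ 9 / 10 / Real.pi) :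
    ((1 + 3 * p) / 2) ^ numProj n ≤ 1 / (40 * n) := by
  have hn' : (0 : ℝ) < 40 * n := by positivity
  have h1 : p ≤ 9 / 10 / 3.14 :=
    hp.trans (div_le_div_of_nonneg_left (by norm_num) (by norm_num) Real.pi_gt_d2.le)
  have h2 : (1 + 3 * p) / 2 ≤ Real.exp (-(1 / 15)) := by
    have := Real.add_one_le_exp (-(1 / 15))
    norm_num at h1
    linarith
  have h3 : 15 * Real.log (40 * n) ≤ numProj n := Nat.le_ceil _
  calc ((1 + 3 * p) / 2) ^ numProj n ≤ Real.exp (-(1 / 15)) ^ numProj n := by gcongr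
    _ = Real.exp (-(numProj n / 15)) := by rw [← Real.exp_nat_mul]; ring_nf
    _ ≤ Real.exp (-Real.log (40 * n)) := by
        apply Real.exp_le_exp.2; linarith
    _ = _ := by rw [Real.exp_neg, Real.exp_log hn', one_div]

/-- The median of the absolute values of Cauchy projections of `u` is within a constant factor of
the `ℓ1` norm of `u`. -/
theorem real_median_not_mem_le {n d : ℕ} (hn : 0 < n) (u : Fin d → ℝ) :
    (Measure.pi fun _ : Fin d => Measure.pi fun _ : Fin (numProj n) => cauchyMeasure 0 1).real
      {G | ¬ (9 / 20 * ∑ k, |u k| ≤ median (fun l => |∑ k, u k * G k l|) ∧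
        median (fun l => |∑ k, u k * G k l|) ≤ 20 / 9 * ∑ k, |u k|)} ≤ 1 / (20 * n) := by
  have hr := numProj_pos hn
  set r := numProj n with hrdef
  set c := ∑ k, |u k| with hc
  have hc0 : 0 ≤ c := Finset.sum_nonneg fun k _ => abs_nonneg (u k)
  set T : Set (Fin r → ℝ) := {y | ¬ (9 / 20 * c ≤ median (fun l => |y l|) ∧
    median (fun l => |y l|) ≤ 20 / 9 * c)} with hT
  have hmed : Measurable fun y : Fin r → ℝ => median (fun l => |y l|) :=
    (measurable_median hr).comp (by fun_prop)
  have hTm : MeasurableSet T :=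
    ((measurableSet_le measurable_const hmed).inter (measurableSet_le hmed measurable_const)).compl
  have hpre : (Measure.pi fun _ : Fin d => Measure.pi fun _ : Fin r => cauchyMeasure 0 1).real
      {G | (fun l => ∑ k, u k * G k l) ∈ T} =
      (Measure.pi fun _ : Fin r => cauchyMeasure 0 1).real {x | (fun l => c * x l) ∈ T} := by
    have h1 := map_measureReal_apply (μ := Measure.pi fun _ : Fin d => Measure.pi fun _ : Fin r =>
      cauchyMeasure 0 1) (f := fun G l => ∑ k, u k * G k l) (by fun_prop) hTm
    have h2 := map_measureReal_apply (μ := Measure.pi fun _ : Fin r =>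
      cauchyMeasure 0 1) (f := fun x l => c * x l) (by fun_prop) hTm
    rw [map_sum_mul_pi_cauchyMeasure, h2] at h1
    exact h1.symm
  refine hpre.trans_le ?_
  -- For a zero vector both inequalities hold trivially; otherwise the scale c cancels.
  rcases hc0.eq_or_lt with h0 | hcpos
  · have : {x : Fin r → ℝ | (fun l => c * x l) ∈ T} = ∅ := by
      ext x
      simp [hT, ← h0, median_zero]
    rw [this]
    simp
  · have hsub : {x : Fin r → ℝ | (fun l => c * x l) ∈ T} ⊆
        {x | r ≤ 2 * (Finset.univ.filter fun l => |x l| < 9 / 20).card} ∪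
        {x | r ≤ 2 * (Finset.univ.filter fun l => 20 / 9 < |x l|).card} := by
      intro x hx
      simp only [hT, Set.mem_ofPred_eq, not_and_or, not_le, abs_mul, abs_of_pos hcpos] at hx
      rcases hx with hx | hx
      · left
        refine (le_card_of_median_lt hr hx).trans (le_of_eq ?_)
        simp only [mul_comm (9 / 20 : ℝ) c, mul_lt_mul_iff_right₀ hcpos]
      · right
        refine (le_card_of_lt_median hr hx).trans (le_of_eq ?_)
        simp only [mul_comm (20 / 9 : ℝ) c, mul_lt_mul_iff_right₀ hcpos]
    refine (measureReal_mono hsub).trans ((measureReal_union_le _ _).trans ?_)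
    have hp1 := cauchyMeasure_abs_lt_le (a := 9 / 20) (by norm_num)
    have hp2 := cauchyMeasure_lt_abs_le (b := 20 / 9) (by norm_num)
    have e1 := pi_real_half_card_le (r := r)
      (measurableSet_lt (measurable_id.abs) measurable_const) hp1
    have e2 := pi_real_half_card_le (r := r)
      (measurableSet_lt measurable_const (measurable_id.abs)) hp2
    have hq1 := pow_numProj_le hn (p := 2 * (9 / 20) / Real.pi) (by positivity)
      (le_of_eq (by ring))
    have hq2 := pow_numProj_le hn (p := 2 / (20 / 9 * Real.pi)) (by positivity)
      (le_of_eq (by field_simp; norm_num))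
    have : 1 / (20 * n : ℝ) = 1 / (40 * n) + 1 / (40 * n) := by
      have : (0 : ℝ) < n := by exact_mod_cast hn
      field_simp; norm_num
    rw [this]
    exact add_le_add (e1.trans hq1) (e2.trans hq2)

/-- The estimates of all row norms are within a constant factor of the row norms. -/
def GoodEstimates {n d r : ℕ} (A : Matrix (Fin n) (Fin d) ℝ) (R : Matrix (Fin d) (Fin d) ℝ)
    (G : Fin d → Fin r → ℝ) : Prop :=
  ∀ i, 9 / 20 * ∑ k, |(A * R⁻¹) i k| ≤ rowEstimate A R (Matrix.of G) i ∧
    rowEstimate A R (Matrix.of G) i ≤ 20 / 9 * ∑ k, |(A * R⁻¹) i k|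

theorem rowEstimate_eq_median {n d r : ℕ} (A : Matrix (Fin n) (Fin d) ℝ)
    (R : Matrix (Fin d) (Fin d) ℝ) (G : Fin d → Fin r → ℝ) (i : Fin n) :
    rowEstimate A R (Matrix.of G) i = median fun l => |∑ k, (A * R⁻¹) i k * G k l| := by
  rw [rowEstimate, ← Matrix.mul_assoc]
  rfl

theorem real_not_goodEstimates_le {n d : ℕ} (hn : 0 < n) (A : Matrix (Fin n) (Fin d) ℝ)
    (R : Matrix (Fin d) (Fin d) ℝ) :
    (Measure.pi fun _ : Fin d => Measure.pi fun _ : Fin (numProj n) => cauchyMeasure 0 1).real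
      {G | ¬ GoodEstimates A R G} ≤ 1 / 20 := by
  have h : {G : Fin d → Fin (numProj n) → ℝ | ¬ GoodEstimates A R G} =
      ⋃ i, {G | ¬ (9 / 20 * ∑ k, |(A * R⁻¹) i k| ≤ median (fun l => |∑ k, (A * R⁻¹) i k * G k l|) ∧
        median (fun l => |∑ k, (A * R⁻¹) i k * G k l|) ≤ 20 / 9 * ∑ k, |(A * R⁻¹) i k|)} := by
    ext G
    simp only [GoodEstimates, rowEstimate_eq_median, not_forall, Set.mem_ofPred_eq, Set.mem_iUnion]
  rw [h]
  refine (measureReal_iUnion_fintype_le _).trans ?_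
  refine (Finset.sum_le_sum fun i _ => real_median_not_mem_le hn _).trans (le_of_eq ?_)
  have : (0 : ℝ) < n := by exact_mod_cast hn
  simp
  field_simp

end QuantileSampling

namespace QuantileSampling

/-! ### Coin tosses -/

theorem measurableSet_coe_lt (p : ℝ) : MeasurableSet {u : unitInterval | (u : ℝ) < p} :=
  measurableSet_lt measurable_subtype_coe measurable_const

theorem volume_real_coe_lt {p : ℝ} (h0 : 0 ≤ p) (h1 : p ≤ 1) :
    (volume : Measure unitInterval).real {u | (u : ℝ) < p} = p := by
  have h : {u : unitInterval | (u : ℝ) < p} = ((↑) : unitInterval → ℝ) ⁻¹' (Set.Iio p) := rfl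
  rw [h, Measure.real, (unitInterval.measurePreserving_coe).measure_preimage
    measurableSet_Iio.nullMeasurableSet, Measure.restrict_apply measurableSet_Iio]
  have : Set.Iio p ∩ Set.Icc 0 1 = Set.Ico 0 p := by
    ext x
    simp only [Set.mem_inter_iff, Set.mem_Iio, Set.mem_Icc, Set.mem_Ico]
    constructor
    · rintro ⟨a, b, c⟩; exact ⟨b, a⟩
    · rintro ⟨a, b⟩; exact ⟨b, a, b.le.trans h1⟩
  rw [this, Real.volume_Ico, sub_zero, ENNReal.toReal_ofReal h0]

theorem ite_coin_eq (p a b : ℝ) : (fun u : unitInterval => if (u : ℝ) < p then a else b) =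
    fun u => b + {u : unitInterval | (u : ℝ) < p}.indicator (fun _ => a - b) u := by
  ext u
  by_cases h : (u : ℝ) < p <;> simp [h]

theorem integrable_coin (p a b : ℝ) :
    Integrable (fun u : unitInterval => if (u : ℝ) < p then a else b) := by
  rw [ite_coin_eq]
  exact (integrable_const _).add ((integrable_const _).indicator (measurableSet_coe_lt p))

theorem integral_coin {p : ℝ} (h0 : 0 ≤ p) (h1 : p ≤ 1) (a b : ℝ) :
    ∫ u : unitInterval, (if (u : ℝ) < p then a else b) = p * a + (1 - p) * b := by
  rw [ite_coin_eq, integral_add (integrable_const _)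
    ((integrable_const _).indicator (measurableSet_coe_lt p)),
    integral_indicator (measurableSet_coe_lt p)]
  simp [volume_real_coe_lt h0 h1]
  ring

/-- Markov's inequality for a product of functions of independent coin tosses. -/
theorem coin_markov {n : ℕ} {p a b : Fin n → ℝ} (h0 : ∀ i, 0 ≤ p i) (h1 : ∀ i, p i ≤ 1)
    (ha : ∀ i, 0 ≤ a i) (hb : ∀ i, 0 ≤ b i) {B T : ℝ} (hT : 0 < T)
    (hB : ∏ i, (p i * a i + (1 - p i) * b i) ≤ B) :
    (Measure.pi fun _ : Fin n => (volume : Measure unitInterval)).real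
      {u | T ≤ ∏ i, if (u i : ℝ) < p i then a i else b i} ≤ B / T := by
  have hM := mul_meas_ge_le_integral_of_nonneg
    (μ := Measure.pi fun _ : Fin n => (volume : Measure unitInterval))
    (f := fun u => ∏ i, if (u i : ℝ) < p i then a i else b i)
    (ae_of_all _ fun x => Finset.prod_nonneg fun l _ => by
      split_ifs; exacts [ha l, hb l])
    (Integrable.fintype_prod (f := fun i (u : unitInterval) => if (u : ℝ) < p i then a i else b i)
      fun i => integrable_coin _ _ _) T
  rw [integral_fintype_prod_eq_prod
    (f := fun i (u : unitInterval) => if (u : ℝ) < p i then a i else b i)] at hM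
  simp only [integral_coin (h0 _) (h1 _)] at hM
  rw [le_div_iff₀ hT, mul_comm]
  exact hM.trans hB

/-- For p < 1 the exponent y = θw/p has |y| ≤ 1, so exp y ≤ 1 + y + y² and the mean is at most 1 +
θw + θ²(w/p)w with w/p ≤ M. For p = 1 nothing is random, so w needs no bound there; for p = 0 the
hypothesis forces w = 0. -/
theorem coin_mgf_le {p w M θ : ℝ} (h0 : 0 ≤ p) (h1 : p ≤ 1) (hw : 0 ≤ w) (hM : 0 < M)
    (h : p < 1 → w ≤ M * p) (hθ : |θ| * M ≤ 1) :
    p * Real.exp (θ * (w / p)) + (1 - p) * 1 ≤ Real.exp (θ * w + θ ^ 2 * M * w) := by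
  have hMw : 0 ≤ θ ^ 2 * M * w := by positivity
  rcases h1.eq_or_lt with rfl | h1
  · simp only [div_one, one_mul, sub_self, mul_one, add_zero]
    exact Real.exp_le_exp.2 (by linarith)
  · have hwp := h h1
    rcases h0.eq_or_lt with rfl | h0
    · have : w = 0 := le_antisymm (by linarith) hw
      simp [this]
    · have hdiv : w / p ≤ M := (div_le_iff₀ h0).2 hwp
      have hdiv0 : 0 ≤ w / p := by positivity
      have hy : |θ * (w / p)| ≤ 1 := by
        rw [abs_mul, abs_of_nonneg hdiv0]
        exact (mul_le_mul_of_nonneg_left hdiv (abs_nonneg θ)).trans hθ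
      have h2 := (abs_le.1 (Real.abs_exp_sub_one_sub_id_le hy)).2
      have h3 : p * (θ * (w / p)) = θ * w := by field_simp
      have h4 : p * (θ * (w / p)) ^ 2 = θ ^ 2 * (w / p) * w := by field_simp
      have h5 : θ ^ 2 * (w / p) * w ≤ θ ^ 2 * M * w := by gcongr
      have h6 := mul_le_mul_of_nonneg_left h2 h0.le
      have h7 := Real.add_one_le_exp (θ * w + θ ^ 2 * M * w)
      nlinarith

/-- A Bernstein type inequality for sums of independent reweighted coin tosses. -/
theorem coin_bernstein {n : ℕ} {p w : Fin n → ℝ} {M t : ℝ} (h0 : ∀ i, 0 ≤ p i)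
    (h1 : ∀ i, p i ≤ 1) (hw : ∀ i, 0 ≤ w i) (hM : 0 < M) (h : ∀ i, p i < 1 → w i ≤ M * p i)
    (ht0 : 0 ≤ t) (ht : t ≤ 2) :
    (Measure.pi fun _ : Fin n => (volume : Measure unitInterval)).real
      {u | t * ∑ i, w i < |(∑ i, if (u i : ℝ) < p i then w i / p i else 0) - ∑ i, w i|} ≤
      2 * Real.exp (-(t ^ 2 * (∑ i, w i) / (4 * M))) := by
  set W := ∑ i, w i with hW
  -- The choice |θ| = t/(2M) minimizes θ²M - |θ|t, with value -t²/(4M); t ≤ 2 ensures |θ|M ≤ 1. The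
  -- two signs of θ give the two tails.
  have key : ∀ θ : ℝ, |θ| = t / (2 * M) →
      (Measure.pi fun _ : Fin n => (volume : Measure unitInterval)).real
        {u | Real.exp (θ * W + |θ| * t * W) ≤
          ∏ i, if (u i : ℝ) < p i then Real.exp (θ * (w i / p i)) else 1} ≤
        Real.exp (-(t ^ 2 * W / (4 * M))) := by
    intro θ hθ
    have hθM : |θ| * M ≤ 1 := by rw [hθ]; field_simp; linarith
    refine (coin_markov h0 h1 (fun i => (Real.exp_pos _).le) (fun _ => zero_le_one)
      (Real.exp_pos _) (Finset.prod_le_prod (fun i _ => ?_)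
        fun i _ => coin_mgf_le (h0 i) (h1 i) (hw i) hM (h i) hθM)).trans (le_of_eq ?_)
    · exact add_nonneg (mul_nonneg (h0 i) (Real.exp_pos _).le) (by linarith [h1 i])
    · rw [← Real.exp_sum, ← Real.exp_sub, Finset.sum_add_distrib, ← Finset.mul_sum,
        ← Finset.mul_sum, ← hW, ← sq_abs, hθ]
      congr 1
      field_simp
      ring
  have hexp : ∀ (θ : ℝ) (u : Fin n → unitInterval),
      (∏ i, if (u i : ℝ) < p i then Real.exp (θ * (w i / p i)) else 1) =
        Real.exp (θ * ∑ i, if (u i : ℝ) < p i then w i / p i else 0) := by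
    intro θ u
    rw [Finset.mul_sum, Real.exp_sum]
    refine Finset.prod_congr rfl fun i _ => ?_
    split_ifs <;> simp
  have hpos : 0 ≤ t / (2 * M) := by positivity
  have hsub : {u : Fin n → unitInterval |
      t * W < |(∑ i, if (u i : ℝ) < p i then w i / p i else 0) - W|} ⊆
      {u | Real.exp (t / (2 * M) * W + |t / (2 * M)| * t * W) ≤
          ∏ i, if (u i : ℝ) < p i then Real.exp (t / (2 * M) * (w i / p i)) else 1} ∪
      {u | Real.exp (-(t / (2 * M)) * W + |-(t / (2 * M))| * t * W) ≤
          ∏ i, if (u i : ℝ) < p i then Real.exp (-(t / (2 * M)) * (w i / p i)) else 1} := by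
    intro u hu
    simp only [Set.mem_union, Set.mem_ofPred_eq, hexp, Real.exp_le_exp, abs_neg,
      abs_of_nonneg hpos] at hu ⊢
    rcases lt_abs.1 hu with hu | hu
    · left
      have := mul_le_mul_of_nonneg_left hu.le hpos
      linarith
    · right
      have := mul_le_mul_of_nonneg_left hu.le hpos
      linarith
  refine (measureReal_mono hsub).trans ((measureReal_union_le _ _).trans ?_)
  rw [two_mul (Real.exp _)]
  exact add_le_add (key _ (abs_of_nonneg hpos)) (key _ (by rw [abs_neg, abs_of_nonneg hpos]))

/-- A tail bound for the number of successes of independent coin tosses. -/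
theorem coin_count_le {n : ℕ} {p : Fin n → ℝ} {T s : ℝ} (h0 : ∀ i, 0 ≤ p i)
    (h1 : ∀ i, p i ≤ 1) (hs : ∑ i, p i ≤ s) :
    (Measure.pi fun _ : Fin n => (volume : Measure unitInterval)).real
      {u | T < ((Finset.univ.filter fun i => (u i : ℝ) < p i).card : ℝ)} ≤
      Real.exp (s - T * Real.log 2) := by
  -- The mean of 2^(number of successes) is ∏ (1 + p_i) ≤ exp(Σ p_i); Markov's inequality is applied
  -- at level 2^T.
  have h2 : ∏ i, (p i * 2 + (1 - p i) * 1) ≤ Real.exp s := by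
    calc ∏ i, (p i * 2 + (1 - p i) * 1) ≤ ∏ i, Real.exp (p i) := by
          refine Finset.prod_le_prod (fun i _ => by linarith [h0 i]) fun i _ => ?_
          linarith [Real.add_one_le_exp (p i)]
      _ = Real.exp (∑ i, p i) := (Real.exp_sum _ _).symm
      _ ≤ _ := Real.exp_le_exp.2 hs
  have h3 := coin_markov h0 h1 (a := fun _ => 2) (b := fun _ => 1) (fun _ => by norm_num)
    (fun _ => by norm_num) (Real.exp_pos (T * Real.log 2)) h2
  rw [← Real.exp_sub] at h3
  refine (measureReal_mono fun u hu => ?_).trans h3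
  simp only [Set.mem_ofPred_eq] at hu ⊢
  rw [Finset.prod_ite]
  simp only [Finset.prod_const, one_pow, mul_one]
  rw [← Real.rpow_natCast, Real.rpow_def_of_pos (by norm_num), mul_comm (Real.log 2)]
  exact Real.exp_le_exp.2 (mul_le_mul_of_nonneg_right hu.le (Real.log_nonneg (by norm_num)))

/-! ### Nets of unit spheres -/

section Net

open Metric Module ENNReal

variable {E : Type*} [NormedAddCommGroup E] [NormedSpace ℝ E] [FiniteDimensional ℝ E]

/-- The balls of radius γ/2 around the points are disjoint and lie in the ball of radius 1 + γ/2;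
volumes are compared. -/
theorem card_le_of_separated_of_norm_eq_one {γ : ℝ} (hγ : 0 < γ) (s : Finset E)
    (hs : ∀ c ∈ s, ‖c‖ = 1) (h : ∀ c ∈ s, ∀ d ∈ s, c ≠ d → γ ≤ ‖c - d‖) :
    (s.card : ℝ) ≤ (1 + 2 / γ) ^ finrank ℝ E := by
  borelize E
  let μ : Measure E := Measure.addHaar
  let δ : ℝ := γ / 2
  let ρ : ℝ := 1 + γ / 2
  have δpos : 0 < δ := by positivity
  have ρpos : 0 < ρ := by positivity
  set A := ⋃ c ∈ s, ball (c : E) δ with hA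
  have D : Set.Pairwise (s : Set E) (Function.onFun Disjoint fun c => ball (c : E) δ) := by
    rintro c hc d hd hcd
    apply ball_disjoint_ball
    rw [dist_eq_norm, add_halves]
    exact h c hc d hd hcd
  have A_subset : A ⊆ ball (0 : E) ρ := by
    refine Set.iUnion₂_subset fun x hx => ?_
    apply ball_subset_ball'
    rw [dist_zero_right, hs x hx, add_comm]
  have I : (s.card : ℝ≥0∞) * ENNReal.ofReal (δ ^ finrank ℝ E) * μ (ball 0 1) ≤
      ENNReal.ofReal (ρ ^ finrank ℝ E) * μ (ball 0 1) :=
    calc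
      (s.card : ℝ≥0∞) * ENNReal.ofReal (δ ^ finrank ℝ E) * μ (ball 0 1) = μ A := by
        rw [hA, measure_biUnion_finset D fun c _ => measurableSet_ball]
        simp only [μ.addHaar_ball_of_pos _ δpos]
        simp only [Finset.sum_const, nsmul_eq_mul, mul_assoc]
      _ ≤ μ (ball (0 : E) ρ) := measure_mono A_subset
      _ = ENNReal.ofReal (ρ ^ finrank ℝ E) * μ (ball 0 1) := by
        simp only [μ.addHaar_ball_of_pos _ ρpos]
  have J : (s.card : ℝ≥0∞) * ENNReal.ofReal (δ ^ finrank ℝ E) ≤ ENNReal.ofReal (ρ ^ finrank ℝ E) :=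
    (ENNReal.mul_le_mul_iff_left (measure_ball_pos _ _ zero_lt_one).ne' measure_ball_lt_top.ne).1 I
  have K : (s.card : ℝ) * δ ^ finrank ℝ E ≤ ρ ^ finrank ℝ E := by
    have := ENNReal.toReal_mono ENNReal.ofReal_ne_top J
    rwa [ENNReal.toReal_mul, ENNReal.toReal_natCast, ENNReal.toReal_ofReal (by positivity),
      ENNReal.toReal_ofReal (by positivity)] at this
  have : 1 + 2 / γ = ρ / δ := by simp only [ρ, δ]; field_simp; ring
  rw [this, div_pow, le_div_iff₀ (by positivity)]
  exact K

/-- The unit sphere of a finite-dimensional normed space has a small net. -/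
theorem exists_net_sphere {γ : ℝ} (hγ : 0 < γ) :
    ∃ s : Finset E, (∀ c ∈ s, ‖c‖ = 1) ∧ (s.card : ℝ) ≤ (1 + 2 / γ) ^ finrank ℝ E ∧
      ∀ v : E, ‖v‖ = 1 → ∃ c ∈ s, ‖v - c‖ ≤ γ := by
  classical
  set P : Set ℕ := {k | ∃ s : Finset E, s.card = k ∧ (∀ c ∈ s, ‖c‖ = 1) ∧
    ∀ c ∈ s, ∀ d ∈ s, c ≠ d → γ ≤ ‖c - d‖} with hP
  have hne : P.Nonempty := ⟨0, ∅, by simp⟩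
  have hbdd : BddAbove P := by
    refine ⟨⌊(1 + 2 / γ) ^ finrank ℝ E⌋₊, ?_⟩
    rintro k ⟨s, rfl, hs, h⟩
    exact Nat.le_floor (card_le_of_separated_of_norm_eq_one hγ s hs h)
  -- A separated set of maximal cardinality is a net: a point of the sphere farther than γ from it
  -- could be added.
  obtain ⟨s, hcard, hs, h⟩ := Nat.sSup_mem hne hbdd
  refine ⟨s, hs, card_le_of_separated_of_norm_eq_one hγ s hs h, fun v hv => ?_⟩
  by_contra! hcon
  have hvs : v ∉ s := fun hvs => by
    have := hcon v hvs
    simp at this; linarith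
  have : s.card + 1 ∈ P := by
    refine ⟨insert v s, Finset.card_insert_of_notMem hvs, ?_, ?_⟩
    · simp only [Finset.mem_insert, forall_eq_or_imp]
      exact ⟨hv, hs⟩
    · intro c hc d hd hcd
      rcases Finset.mem_insert.1 hc with hc' | hc' <;> rcases Finset.mem_insert.1 hd with hd' | hd'
      · exact absurd (hc'.trans hd'.symm) hcd
      · rw [hc']; exact (hcon d hd').le
      · rw [hd', norm_sub_rev]; exact (hcon c hc').le
      · exact h c hc' d hd' hcd
  have := le_csSup hbdd this
  omega

end Net

/-- The `ℓ1` unit sphere of the range of a matrix has a small net. -/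
theorem exists_net_range {n d : ℕ} (U : Matrix (Fin n) (Fin d) ℝ) {γ : ℝ} (hγ : 0 < γ) :
    ∃ s : Finset (Fin n → ℝ), (∀ z ∈ s, (∃ x, z = U.mulVec x) ∧ ∑ i, |z i| = 1) ∧
      (s.card : ℝ) ≤ (1 + 2 / γ) ^ d ∧
      ∀ x, ∑ i, |U.mulVec x i| = 1 → ∃ z ∈ s, ∑ i, |U.mulVec x i - z i| ≤ γ := by
  classical
  -- The net lives in the range, of dimension at most d, with the ℓ1 norm; this makes the exponent d
  -- instead of n.
  set f : (Fin d → ℝ) →ₗ[ℝ] PiLp 1 (fun _ : Fin n => ℝ) :=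
    (WithLp.linearEquiv 1 ℝ (Fin n → ℝ)).symm.toLinearMap ∘ₗ U.mulVecLin with hf
  obtain ⟨s, hs, hcard, hnet⟩ := exists_net_sphere (E := LinearMap.range f) hγ
  have hnorm : ∀ y : PiLp 1 (fun _ : Fin n => ℝ), ‖y‖ = ∑ i, |y i| := by
    intro y
    rw [PiLp.norm_eq_of_L1]
    rfl
  refine ⟨s.image fun z : LinearMap.range f => WithLp.ofLp (z : PiLp 1 (fun _ : Fin n => ℝ)), ?_, ?_, ?_⟩
  · intro z hz
    obtain ⟨y, hy, rfl⟩ := Finset.mem_image.1 hz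
    obtain ⟨x, hx⟩ := y.2
    refine ⟨⟨x, ?_⟩, ?_⟩
    · rw [← hx]; rfl
    · have := hs y hy
      rw [Submodule.coe_norm, hnorm] at this
      exact this
  · refine (Nat.cast_le.2 Finset.card_image_le).trans (hcard.trans ?_)
    refine pow_le_pow_right₀ (by have : 0 < 2 / γ := by positivity
                                 linarith) ?_
    exact (LinearMap.finrank_range_le f).trans (by simp)
  · intro x hx
    obtain ⟨c, hc, hxc⟩ := hnet ⟨f x, x, rfl⟩ (by rw [Submodule.coe_norm, hnorm]; exact hx)
    refine ⟨_, Finset.mem_image_of_mem _ hc, ?_⟩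
    rw [Submodule.coe_norm, hnorm] at hxc
    exact hxc

/-! ### The quantile loss -/

section Loss

variable {n : ℕ} {τ : ℝ}

/-- A maximum of two linear functions is subadditive, which stands in for the triangle inequality:
ρ_τ is not even in general. -/
theorem rho_eq_max (z : ℝ) : rho τ z = max (τ * z) ((τ - 1) * z) := by
  unfold rho
  split_ifs with h
  · rw [max_eq_left (by nlinarith)]
  · rw [max_eq_right (by nlinarith)]

theorem rho_mul_of_nonneg {c : ℝ} (hc : 0 ≤ c) (z : ℝ) : rho τ (c * z) = c * rho τ z := by
  rcases hc.eq_or_lt with rfl | hc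
  · simp [rho]
  · simp only [rho, mul_nonneg_iff_of_pos_left hc]
    split_ifs <;> ring

theorem rho_add_le (y z : ℝ) : rho τ (y + z) ≤ rho τ y + rho τ z := by
  simp only [rho_eq_max]
  refine max_le ?_ ?_
  · have := le_max_left (τ * y) ((τ - 1) * y)
    have := le_max_left (τ * z) ((τ - 1) * z)
    linarith
  · have := le_max_right (τ * y) ((τ - 1) * y)
    have := le_max_right (τ * z) ((τ - 1) * z)
    linarith

theorem rho_le (h0 : 1 / 2 ≤ τ) (z : ℝ) : rho τ z ≤ τ * |z| := by
  unfold rho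
  split_ifs with h
  · rw [abs_of_nonneg h]
  · rw [abs_of_neg (not_le.1 h)]; nlinarith

theorem le_rho (h0 : 1 / 2 ≤ τ) (z : ℝ) : (1 - τ) * |z| ≤ rho τ z := by
  unfold rho
  split_ifs with h
  · rw [abs_of_nonneg h]; exact mul_le_mul_of_nonneg_right (by linarith) h
  · rw [abs_of_neg (not_le.1 h)]; nlinarith

theorem rho_nonneg (h0 : 1 / 2 ≤ τ) (h1 : τ < 1) (z : ℝ) : 0 ≤ rho τ z :=
  (mul_nonneg (by linarith) (abs_nonneg z)).trans (le_rho h0 z)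

theorem quantileLoss_add_le (y z : Fin n → ℝ) :
    quantileLoss τ (y + z) ≤ quantileLoss τ y + quantileLoss τ z := by
  unfold quantileLoss
  rw [← Finset.sum_add_distrib]
  exact Finset.sum_le_sum fun i _ => rho_add_le _ _

theorem quantileLoss_smul {c : ℝ} (hc : 0 ≤ c) (z : Fin n → ℝ) :
    quantileLoss τ (c • z) = c * quantileLoss τ z := by
  unfold quantileLoss
  rw [Finset.mul_sum]
  exact Finset.sum_congr rfl fun i _ => rho_mul_of_nonneg hc _

theorem quantileLoss_le (h0 : 1 / 2 ≤ τ) (z : Fin n → ℝ) :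
    quantileLoss τ z ≤ τ * ∑ i, |z i| := by
  unfold quantileLoss
  rw [Finset.mul_sum]
  exact Finset.sum_le_sum fun i _ => rho_le h0 _

theorem le_quantileLoss (h0 : 1 / 2 ≤ τ) (z : Fin n → ℝ) :
    (1 - τ) * ∑ i, |z i| ≤ quantileLoss τ z := by
  unfold quantileLoss
  rw [Finset.mul_sum]
  exact Finset.sum_le_sum fun i _ => le_rho h0 _

end Loss

/-- A reweighting that preserves the loss on a net of the unit sphere of a subspace preserves it on
the whole subspace. -/
theorem distortion_of_net {n d : ℕ} {τ ε : ℝ} (h0 : 1 / 2 ≤ τ) (h1 : τ < 1) (hε0 : 0 < ε)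
    (hε : ε < 1 / 2) (U : Matrix (Fin n) (Fin d) ℝ) {D : Fin n → ℝ} (hD : ∀ i, 0 ≤ D i)
    {s : Finset (Fin n → ℝ)} (hs : ∀ z ∈ s, (∃ x, z = U.mulVec x) ∧ ∑ i, |z i| = 1)
    (hnet : ∀ x, ∑ i, |U.mulVec x i| = 1 →
      ∃ z ∈ s, ∑ i, |U.mulVec x i - z i| ≤ ε / (6 * (τ / (1 - τ))))
    (hgood : ∀ z ∈ s, |quantileLoss τ (D * z) - quantileLoss τ z| ≤ ε / 2 * quantileLoss τ z)
    (x : Fin d → ℝ) :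
    |quantileLoss τ (D * U.mulVec x) - quantileLoss τ (U.mulVec x)| ≤
      ε * quantileLoss τ (U.mulVec x) := by
  have hτ1 : 0 < 1 - τ := by linarith
  set γ := ε / (6 * (τ / (1 - τ))) with hγ
  -- So a vector of ℓ1 norm γ has loss at most ε/6 times the loss of any unit vector, which is at
  -- least 1 - τ.
  have hγτ : τ * γ = ε * (1 - τ) / 6 := by rw [hγ]; field_simp
  have hγ0 : 0 < γ := by positivity
  have hγ1 : γ ≤ 1 / 12 := by
    have : τ * γ ≤ τ * (1 / 12) := by rw [hγτ]; nlinarith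
    exact le_of_mul_le_mul_left this (by linarith)
  -- the loss of the reweighted vectors, relative to the norm
  set P : Set ℝ := {c | ∃ x, ∑ i, |U.mulVec x i| = 1 ∧ c = quantileLoss τ (D * U.mulVec x)} with hP
  have hbdd : BddAbove P := by
    refine ⟨τ * ∑ i, D i, ?_⟩
    rintro c ⟨x, hx, rfl⟩
    refine (quantileLoss_le h0 _).trans (mul_le_mul_of_nonneg_left ?_ (by linarith))
    refine Finset.sum_le_sum fun i _ => ?_
    rw [Pi.mul_apply, abs_mul, abs_of_nonneg (hD i)]
    refine mul_le_of_le_one_right (hD i) ?_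
    rw [← hx]
    exact Finset.single_le_sum (f := fun i => |U.mulVec x i|) (fun i _ => abs_nonneg _)
      (Finset.mem_univ i)
  set K := sSup P with hK
  have hmulsmul : ∀ (c : ℝ) (v : Fin n → ℝ), D * (c • v) = c • (D * v) := fun c v =>
    mul_smul_comm c D v
  have hscale : ∀ x, quantileLoss τ (D * U.mulVec x) ≤ K * ∑ i, |U.mulVec x i| := by
    intro x
    set ν := ∑ i, |U.mulVec x i| with hν
    have hν0 : 0 ≤ ν := Finset.sum_nonneg fun i _ => abs_nonneg _
    rcases hν0.eq_or_lt with hz | hpos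
    · have : U.mulVec x = 0 := by
        ext i
        have := (Finset.sum_eq_zero_iff_of_nonneg fun i _ => abs_nonneg (U.mulVec x i)).1
          (hν.symm.trans hz.symm) i (Finset.mem_univ i)
        simpa using this
      rw [this, ← hz]
      simp [quantileLoss, rho]
    · have hmem : quantileLoss τ (D * U.mulVec (ν⁻¹ • x)) ∈ P := by
        refine ⟨ν⁻¹ • x, ?_, rfl⟩
        rw [Matrix.mulVec_smul]
        simp only [Pi.smul_apply, smul_eq_mul, abs_mul, abs_of_pos (inv_pos.2 hpos)]
        rw [← Finset.mul_sum, ← hν, inv_mul_cancel₀ hpos.ne']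
      have h2 := le_csSup hbdd hmem
      rw [Matrix.mulVec_smul, hmulsmul, quantileLoss_smul (inv_pos.2 hpos).le] at h2
      rw [← div_le_iff₀ hpos, div_eq_inv_mul]
      exact h2
  have hKnet : ∀ x, ∑ i, |U.mulVec x i| = 1 → ∃ z ∈ s,
      quantileLoss τ (U.mulVec x - z) ≤ τ * γ ∧ quantileLoss τ (z - U.mulVec x) ≤ τ * γ ∧
      quantileLoss τ (D * (U.mulVec x - z)) ≤ K * γ ∧
      quantileLoss τ (D * (z - U.mulVec x)) ≤ K * γ := by
    intro x hx
    have hK0 : 0 ≤ K := by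
      have h2 := hscale x
      rw [hx, mul_one] at h2
      exact (Finset.sum_nonneg fun i _ => rho_nonneg h0 h1 _).trans h2
    obtain ⟨z, hz, hxz⟩ := hnet x hx
    obtain ⟨⟨y, hy⟩, -⟩ := hs z hz
    have hxz' : ∑ i, |z i - U.mulVec x i| ≤ γ := by
      simpa only [abs_sub_comm] using hxz
    refine ⟨z, hz, ?_, ?_, ?_, ?_⟩
    · exact (quantileLoss_le h0 _).trans (mul_le_mul_of_nonneg_left hxz (by linarith))
    · exact (quantileLoss_le h0 _).trans (mul_le_mul_of_nonneg_left hxz' (by linarith))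
    · have h2 := hscale (x - y)
      rw [Matrix.mulVec_sub, ← hy] at h2
      exact h2.trans (mul_le_mul_of_nonneg_left hxz hK0)
    · have h2 := hscale (y - x)
      rw [Matrix.mulVec_sub, ← hy] at h2
      exact h2.trans (mul_le_mul_of_nonneg_left hxz' hK0)
  -- Self-bounding: the distance to the net is again measured by K. As K is finite by `hbdd`, the
  -- term Kγ can be moved to the left.
  have hKle : P.Nonempty → K ≤ (1 + ε / 2) * τ + K * γ := by
    intro hne
    refine csSup_le hne ?_
    rintro c ⟨x, hx, rfl⟩
    obtain ⟨z, hz, -, -, h4, -⟩ := hKnet x hx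
    have h5 := quantileLoss_add_le (τ := τ) (D * z) (D * (U.mulVec x - z))
    rw [← mul_add, add_sub_cancel] at h5
    have h6 := (abs_le.1 (hgood z hz)).2
    have h7 := quantileLoss_le h0 z
    rw [(hs z hz).2, mul_one] at h7
    nlinarith
  -- the bound on the unit sphere
  have hunit : ∀ x, ∑ i, |U.mulVec x i| = 1 →
      |quantileLoss τ (D * U.mulVec x) - quantileLoss τ (U.mulVec x)| ≤
        ε * quantileLoss τ (U.mulVec x) := by
    intro x hx
    have hK1 := hKle ⟨_, x, hx, rfl⟩
    obtain ⟨z, hz, h2, h3, h4, h5⟩ := hKnet x hx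
    have h6 := abs_le.1 (hgood z hz)
    have h7 := quantileLoss_add_le (τ := τ) (D * z) (D * (U.mulVec x - z))
    have h8 := quantileLoss_add_le (τ := τ) (D * U.mulVec x) (D * (z - U.mulVec x))
    have h9 := quantileLoss_add_le (τ := τ) z (U.mulVec x - z)
    have h10 := quantileLoss_add_le (τ := τ) (U.mulVec x) (z - U.mulVec x)
    rw [← mul_add, add_sub_cancel] at h7 h8
    rw [add_sub_cancel] at h9 h10
    have h11 := le_quantileLoss h0 (U.mulVec x)
    rw [hx, mul_one] at h11
    set q := quantileLoss τ (U.mulVec x) with hq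
    -- From 1 + ε/2 ≤ 5/4 and γ ≤ 1/12: (11/12) K ≤ (5/4) τ.
    have hK2 : K ≤ 15 / 11 * τ := by nlinarith
    have hK3 : K * γ ≤ 15 / 66 * (ε * q) := by
      calc K * γ ≤ 15 / 11 * τ * γ := mul_le_mul_of_nonneg_right hK2 hγ0.le
        _ = 15 / 66 * (ε * (1 - τ)) := by rw [mul_assoc, hγτ]; ring
        _ ≤ _ := by gcongr
    have hτγ : τ * γ ≤ ε * q / 6 := by rw [hγτ]; gcongr
    have hτγ0 : 0 ≤ τ * γ := by positivity
    have hτγε : ε / 2 * (τ * γ) ≤ 1 / 4 * (τ * γ) :=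
      mul_le_mul_of_nonneg_right (by linarith) hτγ0
    have hqz : ε / 2 * quantileLoss τ z ≤ ε / 2 * (q + τ * γ) := by gcongr; linarith
    have hεq : 0 ≤ ε * q := by
      have : 0 ≤ q := by linarith
      positivity
    -- The errors add up to at most (1/2 + 1/6 + 1/24 + 15/66) εq, and the bracket is less than 1.
    rw [abs_le]
    constructor <;> nlinarith
  -- homogeneity
  set ν := ∑ i, |U.mulVec x i| with hν
  have hν0 : 0 ≤ ν := Finset.sum_nonneg fun i _ => abs_nonneg _
  rcases hν0.eq_or_lt with hz | hpos
  · have : U.mulVec x = 0 := by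
      ext i
      have := (Finset.sum_eq_zero_iff_of_nonneg fun i _ => abs_nonneg (U.mulVec x i)).1
        (hν.symm.trans hz.symm) i (Finset.mem_univ i)
      simpa using this
    rw [this]
    simp [quantileLoss, rho]
  · have h2 := hunit (ν⁻¹ • x) (by
      rw [Matrix.mulVec_smul]
      simp only [Pi.smul_apply, smul_eq_mul, abs_mul, abs_of_pos (inv_pos.2 hpos)]
      rw [← Finset.mul_sum, ← hν, inv_mul_cancel₀ hpos.ne'])
    have hi := inv_pos.2 hpos
    rw [Matrix.mulVec_smul, hmulsmul, quantileLoss_smul hi.le, quantileLoss_smul hi.le, ← mul_sub,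
      abs_mul, abs_of_pos hi, mul_left_comm] at h2
    exact le_of_mul_le_mul_left h2 hi

end QuantileSampling

namespace QuantileSampling

/-! ### Condition numbers -/

section Conditioning

variable {n d : ℕ}

/-- Hölder's inequality for row i, with the sup norm of x bounded by conditioning. No coordinate can
exceed its row norm times β times the whole norm, so sampling by row norms is safe. -/
theorem IsConditioned.abs_mulVec_le {α β : ℝ} {U : Matrix (Fin n) (Fin d) ℝ}
    (h : IsConditioned α β U) (x : Fin d → ℝ) (i : Fin n) :
    |U.mulVec x i| ≤ (∑ j, |U i j|) * (β * ∑ i, |U.mulVec x i|) := by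
  calc |U.mulVec x i| ≤ ∑ j, |U i j * x j| :=
        Finset.abs_sum_le_sum_abs (fun j => U i j * x j) Finset.univ
    _ ≤ ∑ j, |U i j| * ‖x‖ := by
        refine Finset.sum_le_sum fun j _ => ?_
        rw [abs_mul]
        exact mul_le_mul_of_nonneg_left (norm_le_pi_norm x j) (abs_nonneg _)
    _ = (∑ j, |U i j|) * ‖x‖ := (Finset.sum_mul _ _ _).symm
    _ ≤ _ := mul_le_mul_of_nonneg_left (h.2 x) (Finset.sum_nonneg fun j _ => abs_nonneg _)

/-- For d = 0 the second constant is unconstrained, so the products are unbounded below and have no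
minimum. -/
theorem IsConditionNumber.pos_dim {U : Matrix (Fin n) (Fin d) ℝ} {κ : ℝ}
    (h : IsConditionNumber U κ) : 0 < d := by
  rcases Nat.eq_zero_or_pos d with rfl | hd
  · exfalso
    have : κ - 1 ∈ {c : ℝ | ∃ α β : ℝ, IsConditioned α β U ∧ c = α * β} := by
      refine ⟨1, κ - 1, ⟨by simp, fun x => ?_⟩, by ring⟩
      have h1 : x = 0 := Subsingleton.elim _ _
      subst h1
      simp
    have := h.2 this
    linarith
  · exact hd

theorem IsConditioned.one_le_mul {α β : ℝ} {U : Matrix (Fin n) (Fin d) ℝ}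
    (h : IsConditioned α β U) (j : Fin d) : 1 ≤ β * ∑ i, |U i j| := by
  have h1 := h.2 (Pi.single j 1)
  rw [Pi.norm_single] at h1
  simpa using h1

theorem IsConditioned.pos {α β : ℝ} {U : Matrix (Fin n) (Fin d) ℝ} (h : IsConditioned α β U)
    (hd : 0 < d) : 0 < β ∧ 0 < ∑ i, ∑ j, |U i j| := by
  have h1 := h.one_le_mul ⟨0, hd⟩
  have h2 : 0 ≤ ∑ i, |U i ⟨0, hd⟩| := Finset.sum_nonneg fun i _ => abs_nonneg _
  have hβ : 0 < β := by
    by_contra! hcon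
    nlinarith
  have h3 : 0 < ∑ i, |U i ⟨0, hd⟩| := by
    by_contra! hcon
    nlinarith
  refine ⟨hβ, h3.trans_le (Finset.sum_le_sum fun i _ => ?_)⟩
  exact Finset.single_le_sum (f := fun j => |U i j|) (fun j _ => abs_nonneg _) (Finset.mem_univ _)

/-- Testing on coordinate vectors shows that every column has ℓ1 norm at least 1/β; the columns are
summed. -/
theorem IsConditioned.dim_le {α β : ℝ} {U : Matrix (Fin n) (Fin d) ℝ} (h : IsConditioned α β U)
    (hd : 0 < d) : (d : ℝ) ≤ α * β := by
  have h1 : ∑ _j : Fin d, (1 : ℝ) ≤ ∑ j, β * ∑ i, |U i j| :=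
    Finset.sum_le_sum fun j _ => h.one_le_mul j
  rw [← Finset.mul_sum, Finset.sum_comm] at h1
  simp only [Finset.sum_const, Finset.card_univ, Fintype.card_fin, nsmul_eq_mul, mul_one] at h1
  have h2 := mul_le_mul_of_nonneg_left h.1 (h.pos hd).1.le
  linarith

theorem IsConditionNumber.one_le {U : Matrix (Fin n) (Fin d) ℝ} {κ : ℝ}
    (h : IsConditionNumber U κ) : 1 ≤ κ := by
  obtain ⟨α, β, hαβ, rfl⟩ := h.1
  have h1 : (1 : ℝ) ≤ d := by exact_mod_cast h.pos_dim
  exact h1.trans (hαβ.dim_le h.pos_dim)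

theorem IsConditionNumber.pos_card {U : Matrix (Fin n) (Fin d) ℝ} {κ : ℝ}
    (h : IsConditionNumber U κ) : 0 < n := by
  obtain ⟨α, β, hαβ, -⟩ := h.1
  rcases Nat.eq_zero_or_pos n with rfl | hn
  · have := (hαβ.pos h.pos_dim).2
    simp at this
  · exact hn

end Conditioning

/-! ### The sampling complexity -/

section SampleSize

variable {d : ℕ} {κ ε τ : ℝ} (hd : 0 < d) (hκ : 1 ≤ κ) (hε0 : 0 < ε) (hε : ε < 1 / 2)
  (h0 : 1 / 2 ≤ τ) (h1 : τ < 1)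
include h0 h1

theorem one_le_odds : 1 ≤ τ / (1 - τ) := by
  rw [le_div_iff₀ (by linarith)]; linarith

include hε0 hε

theorem two_lt_odds_div : 2 < τ / (1 - τ) / ε := by
  rw [lt_div_iff₀ hε0]
  have := one_le_odds h0 h1
  linarith

include hd

theorem log_term_pos : 0 < d * Real.log (τ / (1 - τ) * (18 / ε)) + Real.log 80 := by
  have h := two_lt_odds_div hε0 hε h0 h1
  have h2 : 0 ≤ Real.log (τ / (1 - τ) * (18 / ε)) := by
    apply Real.log_nonneg
    rw [mul_div_left_comm]; linarith
  have h3 := Real.log_pos (show (1 : ℝ) < 80 by norm_num)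
  positivity

include hκ

theorem sampleSize_pos : 0 < sampleSize d κ ε τ := by
  have h := log_term_pos hd hε0 hε h0 h1
  have h2 := one_le_odds h0 h1
  unfold sampleSize
  have : 0 < τ / (1 - τ) := by linarith
  have : 0 < κ := by linarith
  positivity

/-- Since μ/ε > 2, the constants are absorbed by l = log(μ/ε): log 18 ≤ 5l and log 80 ≤ 7l, so the
bracket is at most (6 + 7) dl, and 81 · 13 = 1053. -/
theorem sampleSize_le : sampleSize d κ ε τ ≤
    1053 * (τ / (1 - τ) * κ * d * Real.log (τ / (1 - τ) / ε) / ε ^ 2) := by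
  have h := two_lt_odds_div hε0 hε h0 h1
  have hμ := one_le_odds h0 h1
  set μ := τ / (1 - τ)
  set l := Real.log (μ / ε) with hl
  have hd1 : (1 : ℝ) ≤ d := by exact_mod_cast hd
  have hl2 : Real.log 2 ≤ l := Real.log_le_log (by norm_num) h.le
  have hlp : 0 < Real.log 2 := Real.log_pos (by norm_num)
  have e1 : Real.log (μ * (18 / ε)) = Real.log 18 + l := by
    rw [mul_div_left_comm, Real.log_mul (by norm_num) (by linarith)]
  have e2 : Real.log 18 ≤ 5 * l := by
    calc Real.log 18 ≤ Real.log (2 ^ 5) := Real.log_le_log (by norm_num) (by norm_num)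
      _ = 5 * Real.log 2 := by rw [Real.log_pow]; norm_num
      _ ≤ _ := by linarith
  have e3 : Real.log 80 ≤ 7 * l := by
    calc Real.log 80 ≤ Real.log (2 ^ 7) := Real.log_le_log (by norm_num) (by norm_num)
      _ = 7 * Real.log 2 := by rw [Real.log_pow]; norm_num
      _ ≤ _ := by linarith
  have e4 : d * Real.log (μ * (18 / ε)) + Real.log 80 ≤ 13 * (d * l) := by
    rw [e1]
    nlinarith
  calc sampleSize d κ ε τ ≤ μ * (81 * κ / ε ^ 2) * (13 * (d * l)) := by
        unfold sampleSize
        have : 0 < κ := by linarith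
        gcongr
    _ = _ := by ring

theorem complexity_pos : 0 < τ / (1 - τ) * κ * d * Real.log (τ / (1 - τ) / ε) / ε ^ 2 := by
  have h1 := sampleSize_pos hd hκ hε0 hε h0 h1
  have h2 := sampleSize_le hd hκ hε0 hε h0 ‹_›
  linarith

end SampleSize

/-! ### Probabilities of keeping rows -/

section KeepProb

variable {n d r : ℕ} (hr : 0 < r) (A : Matrix (Fin n) (Fin d) ℝ) (R : Matrix (Fin d) (Fin d) ℝ)
  (G : Matrix (Fin d) (Fin r) ℝ)

include hr in
theorem rowEstimate_nonneg (i : Fin n) : 0 ≤ rowEstimate A R G i := by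
  unfold rowEstimate
  by_contra! h
  have h1 := le_card_of_median_lt hr h
  have h2 : (Finset.univ.filter fun l => |(A * (R⁻¹ * G)) i l| < 0) = ∅ :=
    Finset.filter_eq_empty_iff.2 fun l _ => not_lt.2 (abs_nonneg _)
  rw [h2] at h1
  simp at h1
  omega

theorem keepProb_le_one (κ ε τ : ℝ) (i : Fin n) : keepProb A R κ ε τ G i ≤ 1 := min_le_left _ _

include hr in
theorem keepProb_nonneg {κ ε τ : ℝ} (hs : 0 ≤ sampleSize d κ ε τ) (i : Fin n) :
    0 ≤ keepProb A R κ ε τ G i :=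
  le_min zero_le_one (mul_nonneg hs (div_nonneg (rowEstimate_nonneg hr A R G i)
    (Finset.sum_nonneg fun k _ => rowEstimate_nonneg hr A R G k)))

theorem sum_keepProb_le {κ ε τ : ℝ} (hs : 0 ≤ sampleSize d κ ε τ) :
    ∑ i, keepProb A R κ ε τ G i ≤ sampleSize d κ ε τ := by
  calc ∑ i, keepProb A R κ ε τ G i
      ≤ ∑ i, sampleSize d κ ε τ * (rowEstimate A R G i / ∑ k, rowEstimate A R G k) :=
        Finset.sum_le_sum fun i _ => min_le_right _ _
    _ = sampleSize d κ ε τ * ((∑ k, rowEstimate A R G k) / ∑ k, rowEstimate A R G k) := by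
        rw [← Finset.mul_sum, Finset.sum_div]
    -- If all estimates vanish, the quotient is 0 by the convention for division by zero.
    _ ≤ _ := mul_le_of_le_one_right hs (div_self_le_one _)

theorem numSampled_eq {κ ε τ : ℝ} (ω : Seed n d r) :
    numSampled (samplingMatrix A R κ ε τ ω) =
      (Finset.univ.filter fun i => (ω.2 i : ℝ) < keepProb A R κ ε τ (Matrix.of ω.1) i).card := by
  unfold numSampled samplingMatrix
  congr 1
  refine Finset.filter_congr fun i _ => ?_
  rw [Matrix.diagonal_apply_eq]
  by_cases h : (ω.2 i : ℝ) < keepProb A R κ ε τ (Matrix.of ω.1) i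
  · simp only [h, if_true, iff_true]
    exact (one_div_pos.2 (pos_keepProb_of_lt A h)).ne'
  · simp [h]

/-- If the estimates of the row norms are good, then rows with a large contribution to the loss are
likely to be kept. -/
theorem rho_le_mul_keepProb {α β ε τ : ℝ} {G : Fin d → Fin r → ℝ} (hd : 0 < d)
    (hU : IsConditioned α β (A * R⁻¹)) (hs : 0 < sampleSize d (α * β) ε τ)
    (h0 : 1 / 2 ≤ τ) (h1 : τ < 1) (hG : GoodEstimates A R G)
    (x : Fin d → ℝ) (i : Fin n) (hi : keepProb A R (α * β) ε τ (Matrix.of G) i < 1) :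
    rho τ ((A * R⁻¹).mulVec x i) ≤
      τ / (1 - τ) * (α * β) * quantileLoss τ ((A * R⁻¹).mulVec x) /
        (81 / 400 * sampleSize d (α * β) ε τ) * keepProb A R (α * β) ε τ (Matrix.of G) i := by
  set U := A * R⁻¹ with hUdef
  set s := sampleSize d (α * β) ε τ with hsdef
  set lam := rowEstimate A R (Matrix.of G) with hlam
  set c : Fin n → ℝ := fun i => ∑ j, |U i j| with hc
  set Q := quantileLoss τ (U.mulVec x) with hQ
  obtain ⟨hβ, hUpos⟩ := hU.pos hd
  have hτ1 : 0 < 1 - τ := by linarith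
  have hci : 0 ≤ c i := Finset.sum_nonneg fun j _ => abs_nonneg _
  have hsum : ∑ k, lam k ≤ 20 / 9 * ∑ k, c k := by
    rw [Finset.mul_sum]; exact Finset.sum_le_sum fun k _ => (hG k).2
  have hsum' : 9 / 20 * ∑ k, c k ≤ ∑ k, lam k := by
    rw [Finset.mul_sum]; exact Finset.sum_le_sum fun k _ => (hG k).1
  have hcpos : 0 < ∑ k, c k := hUpos
  have hlpos : 0 < ∑ k, lam k := by linarith
  have hp : keepProb A R (α * β) ε τ (Matrix.of G) i = s * (lam i / ∑ k, lam k) := by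
    unfold keepProb at hi ⊢
    rcases min_lt_iff.1 hi with h | h
    · exact absurd h (lt_irrefl _)
    · exact min_eq_right h.le
  have hQ0 : 0 ≤ Q := Finset.sum_nonneg fun i _ => rho_nonneg h0 h1 _
  -- 81/400 = (9/20)²: one factor from the estimate of row i, one from the total.
  have hratio : 81 / 400 * (c i / ∑ k, c k) ≤ lam i / ∑ k, lam k := by
    calc 81 / 400 * (c i / ∑ k, c k) = (9 / 20 * c i) / (20 / 9 * ∑ k, c k) := by
          field_simp; ring
      _ ≤ lam i / ∑ k, lam k := div_le_div₀ ((by positivity : 0 ≤ 9 / 20 * c i).trans (hG i).1)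
          (hG i).1 hlpos hsum
  have hnorm : ∑ k, |U.mulVec x k| ≤ Q / (1 - τ) := by
    rw [le_div_iff₀ hτ1, mul_comm]; exact le_quantileLoss h0 _
  have hτ0 : 0 < τ := by linarith
  have hα : ∑ k, c k ≤ α := hU.1
  calc rho τ (U.mulVec x i) ≤ τ * |U.mulVec x i| := rho_le h0 _
    _ ≤ τ * (c i * (β * ∑ k, |U.mulVec x k|)) :=
        mul_le_mul_of_nonneg_left (hU.abs_mulVec_le x i) hτ0.le
    _ ≤ τ * (c i * (β * (Q / (1 - τ)))) := by gcongr
    _ = τ / (1 - τ) * β * Q * (∑ k, c k) * (c i / ∑ k, c k) := by field_simp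
    _ ≤ τ / (1 - τ) * β * Q * α * (c i / ∑ k, c k) := by gcongr
    _ = τ / (1 - τ) * (α * β) * Q / (81 / 400 * s) * (s * (81 / 400 * (c i / ∑ k, c k))) := by
        field_simp
    _ ≤ τ / (1 - τ) * (α * β) * Q / (81 / 400 * s) * (s * (lam i / ∑ k, lam k)) := by
        have hαpos : 0 < α := hcpos.trans_le hα
        gcongr
    _ = _ := by rw [hp]

end KeepProb

/-! ### Probabilities of events -/

section Seed

variable {n d r : ℕ}

instance : IsProbabilityMeasure (seedLaw n d r) := by unfold seedLaw; infer_instance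

/-- Fubini: a bound for the coins that is uniform in the Cauchy matrix holds unconditionally. -/
theorem seedLaw_real_le {E : Set (Seed n d r)} (hE : MeasurableSet E) {c : ℝ} (hc : 0 ≤ c)
    (h : ∀ g : Fin d → Fin r → ℝ,
      (Measure.pi fun _ : Fin n => (volume : Measure unitInterval)).real {u | (g, u) ∈ E} ≤ c) :
    (seedLaw n d r).real E ≤ c := by
  refine ENNReal.toReal_le_of_le_ofReal hc ?_
  unfold seedLaw
  rw [Measure.prod_apply hE]
  calc _ ≤ ∫⁻ _ : Fin d → Fin r → ℝ, ENNReal.ofReal c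
        ∂(Measure.pi fun _ => Measure.pi fun _ => cauchyMeasure 0 1) := by
        refine lintegral_mono fun g => ?_
        rw [← ENNReal.ofReal_toReal (measure_ne_top _ (Prod.mk g ⁻¹' E))]
        exact ENNReal.ofReal_le_ofReal (h g)
    _ = ENNReal.ofReal c := by simp

theorem seedLaw_real_fst (P : Set (Fin d → Fin r → ℝ)) :
    (seedLaw n d r).real {ω | ω.1 ∈ P} =
      (Measure.pi fun _ => Measure.pi fun _ => cauchyMeasure 0 1).real P := by
  have : {ω : Seed n d r | ω.1 ∈ P} = P ×ˢ Set.univ := by ext; simp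
  rw [this]
  unfold seedLaw
  rw [measureReal_prod_prod]
  simp

/-- Uses only subadditivity, so E and B need not be measurable. -/
theorem one_sub_le_of_compl_subset {E B : Set (Seed n d r)} {c : ℝ} (h : Eᶜ ⊆ B)
    (hB : (seedLaw n d r).real B ≤ c) : 1 - c ≤ (seedLaw n d r).real E := by
  have h1 : (seedLaw n d r).real (E ∪ B) = 1 := by
    have : E ∪ B = Set.univ := by
      ext ω
      by_cases hω : ω ∈ E
      · simp [hω]
      · simp [h hω]
    rw [this]; simp
  have h2 := measureReal_union_le (μ := seedLaw n d r) E B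
  linarith

variable (A : Matrix (Fin n) (Fin d) ℝ) (R : Matrix (Fin d) (Fin d) ℝ)

theorem measurableSet_goodEstimates (hr : 0 < r) :
    MeasurableSet {G : Fin d → Fin r → ℝ | GoodEstimates A R G} := by
  simp only [GoodEstimates, rowEstimate_eq_median]
  have h : ∀ i, Measurable fun G : Fin d → Fin r → ℝ =>
      median fun l => |∑ k, (A * R⁻¹) i k * G k l| := fun i =>
    (measurable_median hr).comp (by fun_prop)
  simp only [Set.ofPred_forall]
  exact MeasurableSet.iInter fun i => (measurableSet_le measurable_const (h i)).inter
    (measurableSet_le (h i) measurable_const)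

theorem measurableSet_coin (hr : 0 < r) (κ ε τ : ℝ) (i : Fin n) :
    MeasurableSet {ω : Seed n d r | (ω.2 i : ℝ) < keepProb A R κ ε τ (Matrix.of ω.1) i} :=
  measurableSet_lt (measurable_subtype_coe.comp ((measurable_pi_apply i).comp measurable_snd))
    ((measurable_keepProb hr A R κ ε τ i).comp measurable_fst)

theorem numSampled_tail (hr : 0 < r) {κ ε τ T : ℝ} (hs : 0 ≤ sampleSize d κ ε τ) :
    (seedLaw n d r).real {ω | T < (numSampled (samplingMatrix A R κ ε τ ω) : ℝ)} ≤
      Real.exp (sampleSize d κ ε τ - T * Real.log 2) := by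
  simp only [numSampled_eq]
  refine seedLaw_real_le ?_ (Real.exp_pos _).le fun g => ?_
  · simp only [Finset.card_filter, Nat.cast_sum, Nat.cast_ite, Nat.cast_one, Nat.cast_zero]
    have hm : Measurable fun ω : Seed n d r =>
        ∑ i, if (ω.2 i : ℝ) < keepProb A R κ ε τ (Matrix.of ω.1) i then (1 : ℝ) else 0 :=
      Finset.measurable_sum _ fun i _ => Measurable.ite (measurableSet_coin A R hr κ ε τ i)
        measurable_const measurable_const
    exact measurableSet_lt measurable_const hm
  · have h := coin_count_le (T := T) (p := fun i => keepProb A R κ ε τ (Matrix.of g) i)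
      (fun i => keepProb_nonneg hr A R (Matrix.of g) hs i)
      (fun i => keepProb_le_one A R (Matrix.of g) κ ε τ i) (sum_keepProb_le A R (Matrix.of g) hs)
    simp only [Set.mem_ofPred_eq]
    exact h

/-- The diagonal of the sampling matrix. -/
noncomputable def samplingWeight (κ ε τ : ℝ) (ω : Seed n d r) (i : Fin n) : ℝ :=
  if (ω.2 i : ℝ) < keepProb A R κ ε τ (Matrix.of ω.1) i
    then 1 / keepProb A R κ ε τ (Matrix.of ω.1) i else 0

theorem samplingWeight_nonneg (κ ε τ : ℝ) (ω : Seed n d r) (i : Fin n) :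
    0 ≤ samplingWeight A R κ ε τ ω i := by
  unfold samplingWeight
  split_ifs with h
  · exact (one_div_pos.2 (pos_keepProb_of_lt A h)).le
  · exact le_rfl

theorem quantileLoss_samplingWeight_mul (κ ε τ : ℝ) (ω : Seed n d r) (z : Fin n → ℝ) :
    quantileLoss τ (samplingWeight A R κ ε τ ω * z) =
      ∑ i, if (ω.2 i : ℝ) < keepProb A R κ ε τ (Matrix.of ω.1) i
        then rho τ (z i) / keepProb A R κ ε τ (Matrix.of ω.1) i else 0 := by
  unfold quantileLoss
  refine Finset.sum_congr rfl fun i _ => ?_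
  rw [Pi.mul_apply, rho_mul_of_nonneg (samplingWeight_nonneg A R κ ε τ ω i)]
  unfold samplingWeight
  split_ifs <;> ring

/-- The loss of one vector is preserved with high probability. -/
theorem loss_deviation_le (hr : 0 < r) {κ ε τ : ℝ} (hd : 0 < d)
    (hU : IsConditionNumber (A * R⁻¹) κ) (hε0 : 0 < ε) (hε : ε < 1 / 2) (h0 : 1 / 2 ≤ τ)
    (h1 : τ < 1) (x : Fin d → ℝ) (hx : ∑ i, |(A * R⁻¹).mulVec x i| = 1) :
    (seedLaw n d r).real {ω | GoodEstimates A R ω.1 ∧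
      ε / 2 * quantileLoss τ ((A * R⁻¹).mulVec x) <
        |quantileLoss τ (samplingWeight A R κ ε τ ω * (A * R⁻¹).mulVec x) -
          quantileLoss τ ((A * R⁻¹).mulVec x)|} ≤
      2 * Real.exp (-(d * Real.log (τ / (1 - τ) * (18 / ε)) + Real.log 80)) := by
  have hκ := hU.one_le
  obtain ⟨α, β, hαβ, rfl⟩ := hU.1
  have hs := sampleSize_pos hd hκ hε0 hε h0 h1
  have hL := log_term_pos hd hε0 hε h0 h1
  have hμ := one_le_odds h0 h1
  set z := (A * R⁻¹).mulVec x with hz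
  have hQ : 0 < quantileLoss τ z := by
    have := le_quantileLoss h0 z
    rw [hx] at this
    linarith
  simp only [quantileLoss_samplingWeight_mul]
  refine seedLaw_real_le ?_ (by positivity) fun g => ?_
  · refine ((measurableSet_goodEstimates A R hr).preimage measurable_fst).inter ?_
    have hm : Measurable fun ω : Seed n d r =>
        ∑ i, if (ω.2 i : ℝ) < keepProb A R (α * β) ε τ (Matrix.of ω.1) i
          then rho τ (z i) / keepProb A R (α * β) ε τ (Matrix.of ω.1) i else 0 :=
      Finset.measurable_sum _ fun i _ => Measurable.ite (measurableSet_coin A R hr _ ε τ i)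
        (((measurable_keepProb hr A R _ ε τ i).comp measurable_fst).const_div _) measurable_const
    exact measurableSet_lt measurable_const (hm.sub_const _).abs
  · by_cases hg : GoodEstimates A R g
    · simp only [hg, true_and, Set.mem_ofPred_eq]
      have hM : 0 < τ / (1 - τ) * (α * β) * quantileLoss τ z /
          (81 / 400 * sampleSize d (α * β) ε τ) := by
        have : 0 < τ / (1 - τ) := by linarith
        have : 0 < α * β := by linarith
        positivity
      refine (coin_bernstein (keepProb_nonneg hr A R (Matrix.of g) hs.le)
        (keepProb_le_one A R (Matrix.of g) _ ε τ) (w := fun i => rho τ (z i))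
        (fun i => rho_nonneg h0 h1 _) hM
        (fun i hi => rho_le_mul_keepProb A R hd hαβ hs h0 h1 hg x i hi) (t := ε / 2)
        (by linarith) (by linarith)).trans ?_
      refine mul_le_mul_of_nonneg_left (Real.exp_le_exp.2 (neg_le_neg ?_)) zero_le_two
      change _ ≤ (ε / 2) ^ 2 * quantileLoss τ z / _
      -- The Bernstein exponent: the factors 1/16, 81/400 and the 81 in s multiply to 81²/6400, just
      -- above 1.
      have e : (ε / 2) ^ 2 * quantileLoss τ z / (4 * (τ / (1 - τ) * (α * β) * quantileLoss τ z /
          (81 / 400 * sampleSize d (α * β) ε τ))) = 6561 / 6400 *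
          (d * Real.log (τ / (1 - τ) * (18 / ε)) + Real.log 80) := by
        unfold sampleSize
        generalize d * Real.log (τ / (1 - τ) * (18 / ε)) + Real.log 80 = L
        have hμ0 : τ / (1 - τ) ≠ 0 := by linarith
        have hκ0 : α * β ≠ 0 := by linarith
        generalize τ / (1 - τ) = μ at hμ0
        generalize α * β = κ at hκ0
        field_simp
        ring
      rw [e]
      linarith
    -- With bad estimates the event is empty.
    · simp only [hg, false_and, Set.mem_ofPred_eq]
      simp
      positivity

/-- The sampling matrix preserves the loss of all vectors with high probability. -/
theorem distortion_probability {κ ε τ : ℝ} (hR : IsUnit R.det)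
    (hU : IsConditionNumber (A * R⁻¹) κ) (hε0 : 0 < ε) (hε : ε < 1 / 2) (h0 : 1 / 2 ≤ τ)
    (h1 : τ < 1) : 0.9 ≤ (seedLaw n d (numProj n)).real
      {ω | IsDistortionEmbedding ε τ A (samplingMatrix A R κ ε τ ω)} := by
  have hd := hU.pos_dim
  have hn := hU.pos_card
  have hr := numProj_pos hn
  have hμ := one_le_odds h0 h1
  have hμε := two_lt_odds_div hε0 hε h0 h1
  have hμ0 : 0 < τ / (1 - τ) := by linarith
  obtain ⟨s, hs, hcard, hnet⟩ := exists_net_range (A * R⁻¹)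
    (γ := ε / (6 * (τ / (1 - τ)))) (by positivity)
  set B : (Fin n → ℝ) → Set (Seed n d (numProj n)) := fun z => {ω | GoodEstimates A R ω.1 ∧
      ε / 2 * quantileLoss τ z < |quantileLoss τ (samplingWeight A R κ ε τ ω * z) -
          quantileLoss τ z|} with hB
  have hBz : ∀ z ∈ s, (seedLaw n d (numProj n)).real (B z) ≤
      2 * Real.exp (-(d * Real.log (τ / (1 - τ) * (18 / ε)) + Real.log 80)) := by
    intro z hz
    obtain ⟨⟨x, rfl⟩, hx⟩ := hs z hz
    exact loss_deviation_le A R hr hd hU hε0 hε h0 h1 x hx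
  -- The net bound has base 1 + 12μ/ε, which is at most 18μ/ε because μ/ε > 2.
  have hcard' : (s.card : ℝ) ≤ (τ / (1 - τ) * (18 / ε)) ^ d := by
    refine hcard.trans (pow_le_pow_left₀ (by positivity) ?_ d)
    have e1 : 1 + 2 / (ε / (6 * (τ / (1 - τ)))) = 1 + 12 * (τ / (1 - τ) / ε) := by
      generalize τ / (1 - τ) = μ at hμ0
      field_simp; ring
    rw [e1, mul_div_left_comm (τ / (1 - τ))]
    linarith
  have hexp : Real.exp (-(d * Real.log (τ / (1 - τ) * (18 / ε)) + Real.log 80)) =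
      ((τ / (1 - τ) * (18 / ε)) ^ d)⁻¹ / 80 := by
    rw [neg_add, Real.exp_add, Real.exp_neg, Real.exp_neg, Real.exp_log (by norm_num),
      ← Real.log_pow, Real.exp_log (by positivity)]
    ring
  have hunion : (seedLaw n d (numProj n)).real (⋃ z ∈ s, B z) ≤ 1 / 40 := by
    refine (measureReal_biUnion_finset_le s B).trans ((Finset.sum_le_sum hBz).trans ?_)
    rw [Finset.sum_const, nsmul_eq_mul, hexp]
    have hpos : 0 < (τ / (1 - τ) * (18 / ε)) ^ d := by positivity
    calc (s.card : ℝ) * (2 * (((τ / (1 - τ) * (18 / ε)) ^ d)⁻¹ / 80))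
        ≤ (τ / (1 - τ) * (18 / ε)) ^ d * (2 * (((τ / (1 - τ) * (18 / ε)) ^ d)⁻¹ / 80)) := by
          gcongr
      _ = 1 / 40 := by
          generalize (τ / (1 - τ) * (18 / ε)) ^ d = q at hpos
          field_simp; norm_num
  have hbad : (seedLaw n d (numProj n)).real {ω | ¬ GoodEstimates A R ω.1} ≤ 1 / 20 :=
    (seedLaw_real_fst {G | ¬ GoodEstimates A R G}).trans_le (real_not_goodEstimates_le hn A R)
  -- The failure probabilities 1/20 (estimates) and 1/40 (net) leave more than 0.9.
  refine le_trans ?_ (one_sub_le_of_compl_subset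
    (B := {ω | ¬ GoodEstimates A R ω.1} ∪ ⋃ z ∈ s, B z) (c := 1 / 20 + 1 / 40) ?_
    ((measureReal_union_le _ _).trans (add_le_add hbad hunion)))
  · norm_num
  · rw [Set.compl_subset_comm]
    intro ω hω x
    simp only [Set.mem_compl_iff, Set.mem_union, Set.mem_ofPred_eq, not_or, not_not, Set.mem_iUnion,
      not_exists, hB, not_and, not_lt] at hω
    obtain ⟨hgood, hω⟩ := hω
    have hAx : A.mulVec x = (A * R⁻¹).mulVec (R.mulVec x) := by
      rw [Matrix.mulVec_mulVec, Matrix.nonsing_inv_mul_cancel_right _ _ hR]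
    have hSx : (samplingMatrix A R κ ε τ ω * A).mulVec x =
        samplingWeight A R κ ε τ ω * A.mulVec x := by
      rw [← Matrix.mulVec_mulVec]
      ext i
      rw [samplingMatrix, Matrix.mulVec_diagonal]
      rfl
    have := abs_le.1 (distortion_of_net h0 h1 hε0 hε (A * R⁻¹)
      (samplingWeight_nonneg A R κ ε τ ω) hs hnet (fun z hz => hω z hz hgood) (R.mulVec x))
    rw [← hAx] at this
    rw [hSx]
    constructor <;> linarith

end Seed

end QuantileSampling

/-! ### The proposition -/

theorem proposition3p2 :
    ∃ C₁ C₂ : ℝ, ∃ δ : ℝ → ℝ, Tendsto δ atTop (𝓝 0) ∧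
      ∀ (n d : ℕ) (A : Matrix (Fin n) (Fin d) ℝ) (R : Matrix (Fin d) (Fin d) ℝ) (κ ε τ : ℝ),
        IsUnit R.det → QuantileSampling.IsConditionNumber (A * R⁻¹) κ →
        0 < ε → ε < 1 / 2 → 1 / 2 ≤ τ → τ < 1 →
        -- whatever the random numbers are, the program outputs the sampling matrix,
        -- within the claimed time
        (∀ ω : QuantileSampling.Seed n d (QuantileSampling.numProj n),
          (QuantileSampling.execute A R κ ε τ ω).1 =
            QuantileSampling.diagonalList (QuantileSampling.samplingMatrix A R κ ε τ ω) ∧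
          (2 ≤ n → ((QuantileSampling.execute A R κ ε τ ω).2 : ℝ) ≤
            C₁ * ((QuantileSampling.nnz A + (d : ℝ) ^ 2) * Real.log n)) ∧
          (2 ≤ n → d ^ 2 ≤ QuantileSampling.nnz A →
            ((QuantileSampling.execute A R κ ε τ ω).2 : ℝ) ≤
              C₁ * (QuantileSampling.nnz A * Real.log n))) ∧
        -- the distortion bound
        0.9 ≤ (QuantileSampling.seedLaw n d (QuantileSampling.numProj n)).real
          {ω | QuantileSampling.IsDistortionEmbedding ε τ A
            (QuantileSampling.samplingMatrix A R κ ε τ ω)} ∧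
        -- the number of sampled rows
        1 - δ (τ / (1 - τ) * κ * d * Real.log (τ / (1 - τ) / ε) / ε ^ 2) ≤
          (QuantileSampling.seedLaw n d (QuantileSampling.numProj n)).real
            {ω | (QuantileSampling.numSampled (QuantileSampling.samplingMatrix A R κ ε τ ω) : ℝ) ≤
              C₂ * (τ / (1 - τ) * κ * d * Real.log (τ / (1 - τ) / ε) / ε ^ 2)} := by
  -- 214000 = 2000 · 107, doubled only for convenience; 3159 = 3 · 1053, and 1053 - 3159 log 2 < -1
  -- leaves the tail exp(-N).
  refine ⟨214000 * 2, 3159, fun N => Real.exp (-N), Real.tendsto_exp_neg_atTop_nhds_zero, ?_⟩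
  intro n d A R κ ε τ hR hU hε0 hε h0 h1
  have hd := hU.pos_dim
  have hr := QuantileSampling.numProj_pos hU.pos_card
  have time : ∀ ω : QuantileSampling.Seed n d (QuantileSampling.numProj n), 2 ≤ n →
      ((QuantileSampling.execute A R κ ε τ ω).2 : ℝ) ≤
        214000 * ((QuantileSampling.nnz A + (d : ℝ) ^ 2) * Real.log n) := by
    intro ω hn
    have h2 : ((QuantileSampling.execute A R κ ε τ ω).2 : ℝ) ≤
        2000 * (QuantileSampling.numProj n * (QuantileSampling.nnz A + (d : ℝ) ^ 2)) := by
      exact_mod_cast QuantileSampling.execute_snd_le A R κ ε τ ω hr hd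
    have h3 := mul_le_mul_of_nonneg_right (QuantileSampling.numProj_le hn)
      (show (0 : ℝ) ≤ QuantileSampling.nnz A + (d : ℝ) ^ 2 by positivity)
    linarith
  refine ⟨fun ω => ⟨QuantileSampling.execute_fst A R κ ε τ ω hr, fun hn => ?_, fun hn hnnz => ?_⟩,
    QuantileSampling.distortion_probability A R hR hU hε0 hε h0 h1, ?_⟩
  · refine (time ω hn).trans (mul_le_mul_of_nonneg_right (by norm_num) ?_)
    have := Real.log_nonneg (show (1 : ℝ) ≤ n by exact_mod_cast (by omega : 1 ≤ n))
    positivity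
  · have hlog := Real.log_nonneg (show (1 : ℝ) ≤ n by exact_mod_cast (by omega : 1 ≤ n))
    have h2 : (d : ℝ) ^ 2 ≤ QuantileSampling.nnz A := by exact_mod_cast hnnz
    have h3 := mul_le_mul_of_nonneg_right h2 hlog
    have h4 := time ω hn
    linarith
  · have hκ := hU.one_le
    have hs := QuantileSampling.sampleSize_pos hd hκ hε0 hε h0 h1
    have hsN := QuantileSampling.sampleSize_le hd hκ hε0 hε h0 h1
    have hN := QuantileSampling.complexity_pos hd hκ hε0 hε h0 h1
    set N := τ / (1 - τ) * κ * d * Real.log (τ / (1 - τ) / ε) / ε ^ 2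
    refine QuantileSampling.one_sub_le_of_compl_subset (B := {ω | 3159 * N <
      (QuantileSampling.numSampled (QuantileSampling.samplingMatrix A R κ ε τ ω) : ℝ)}) ?_
      ((QuantileSampling.numSampled_tail A R hr hs.le).trans (Real.exp_le_exp.2 ?_))
    · intro ω hω
      simpa using hω
    · have hl := Real.log_two_gt_d9
      have := mul_le_mul_of_nonneg_left hl.le (show 0 ≤ 3159 * N by linarith)
      linarith
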